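/- Setting. Let $\Omega\subset\mathbb R^d$ be equipped with a metric $\mathsf d$, with open balls $B(x,r)=\{y\in\Omega:\mathsf d(x,y)<r\}$, and with a Borel measure $\mathsf m$ (for example Lebesgue measure on a solid domain or surface measure on a surface) such that all balls are measurable. For $\mathsf w\ge 0$ integrable with respect to $\mathsf m$ write $\mathsf w(E)=\int_E \mathsf w\,d\mathsf m$. The function $\mathsf w$ is a doubling weight if there is $L>0$ with $\mathsf w(B(x,2r))\le L\,\mathsf w(B(x,r))$ for all $x\in\Omega$, $r>0$; the least such $L$ is $L(\mathsf w)$. Let $\Pi_n(\Omega)$ be the space of restrictions to $\Omega$ of real polynomials of total degree at most $n$, let $\|f\|_{p,\mathsf w}=(\int_\Omega|f|^p\mathsf w\,d\mathsf m)^{1/p}$ for $0<p<\infty$, and let $\|f\|_\infty=\sup_\Omega|f|$. Let $\varpi$ be a doubling weight with $\int_\Omega\varpi\,d\mathsf m=1$ for which $\langle f,g\rangle_\varpi=\int_\Omega fg\,\varpi\,d\mathsf m$ is a well-defined inner product on every $\Pi_n(\Omega)$. Let $\mathcal V_n$ be the space of all $f\in\Pi_n(\Omega)$ that are orthogonal to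 $\Pi_k(\Omega)$ for all $k<n$, let $P_n(\cdot,\cdot)$ be the reproducing kernel of $\mathcal V_n$, and let $$L_n(x,y)=\sum_{k=0}^\infty \widehat a(k/n)\,P_k(x,y),\qquad n=1,2,\ldots,$$ where $\widehat a\in C^\infty[0,\infty)$ is nonnegative with $\widehat a=1$ on $[0,1]$ and $\widehat a=0$ on $(2,\infty)$. The space $(\Omega,\varpi,\mathsf d)$ is called localizable if the following hold. (1) For every $\kappa>0$ there is $c_\kappa$ such that for all $n\ge1$ and $x,y\in\Omega$ $$|L_n(x,y)|\le \frac{c_\kappa}{\sqrt{\varpi(B(x,n^{-1}))}\sqrt{\varpi(B(y,n^{-1}))}\,(1+n\mathsf d(x,y))^{\kappa}}.$$ (2) There is $\delta_0\in(0,1)$ such that for every $\kappa>0$ there is $c_\kappa$ such that for all $n\ge1$, $0<\delta\le\delta_0$, $y\in\Omega$ and $x_1\in B(x_2,\delta/n)$ $$|L_n(x_1,y)-L_n(x_2,y)|\le \frac{c_\kappa\, n\,\mathsf d(x_1,x_2)}{\sqrt{\varpi(B(x_1,n^{-1}))}\sqrt{\varpi(B(x_2,n^{-1}))}\,(1+n\mathsf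 d(x_2,y))^{\kappa}}.$$ (3) For all sufficiently large $\kappa>0$ there is $c$ such that for all $n\ge 1$ and $x\in\Omega$ $$\int_\Omega \frac{\varpi(y)}{\varpi(B(y,n^{-1}))(1+n\mathsf d(x,y))^{\kappa}}\,d\mathsf m(y)\le c .$$ A set $\Xi\subset\Omega$ is called maximal $\varepsilon$-separated if $\mathsf d(x,y)\ge\varepsilon$ for distinct $x,y\in\Xi$ and there is a constant $c_d>1$ with $1\le\sum_{z\in\Xi}\chi_{B(z,\varepsilon)}(x)\le c_d$ for all $x\in\Omega$. Theorem. Let $(\Omega,\varpi,\mathsf d)$ be localizable. In the following $\mathsf w$ is a doubling weight on $\Omega$, $n\ge1$ is an integer, $0<\delta\le1$, and $\Xi$ is a maximal $\frac\delta n$-separated subset of $\Omega$. All constants may depend on the localizable space (including $\widehat a$) and on what is indicated, but not on $n$, $m$, $\delta$, $\Xi$, $f$ or otherwise on $\mathsf w$. Maxima and minima over balls are understood as suprema and infima. (i) Let $p_0>0$ and $c\ge 1$. There is a constant $C$, depending on $\mathsf w$ only through $L(\mathsf w)$, and on $p_0$ and $c$, such that for all $p_0\le p<\infty$ and all $f\in\Pi_m(\Omega)$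 with $n\le m\le cn$ $$\Big(\sum_{z\in\Xi}\Big(\max_{x\in B(z,\frac\delta n)}|f(x)|^p\Big)\,\mathsf w\big(B(z,\tfrac\delta n)\big)\Big)^{1/p}\le C\,\|f\|_{p,\mathsf w}.$$ (ii) There is a constant $c$ such that, for every $0<r<1$, there are $\delta_r>0$ and $C$, both depending only on $L(\mathsf w)$ and $r$, such that for $\delta\le\delta_r$, all $r\le p<\infty$ and all $f\in\Pi_n(\Omega)$ $$\|f\|_{p,\mathsf w}\le C\Big(\sum_{z\in\Xi}\Big(\min_{x\in B(z,\frac\delta n)}|f(x)|^p\Big)\,\mathsf w\big(B(z,\tfrac\delta n)\big)\Big)^{1/p}$$ and $$\|f\|_\infty\le c\,\max_{z\in\Xi}|f(z)| .$$ -/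

import Mathlib

open MeasureTheory
open scoped ENNReal ContDiff

noncomputable section

namespace MZ

/-- A set `Ω ⊆ ℝ^d` together with an intrinsic metric (not necessarily the Euclidean one) and a
reference Borel measure `m` (for instance the Lebesgue measure on a solid domain or the surface
measure on an algebraic surface), such that the balls of the intrinsic metric are measurable.
The σ-algebra on `Ω` is the trace of the Borel σ-algebra of `ℝ^d`. -/
structure IntrinsicDomain (d : ℕ) where
  carrier : Set (EuclideanSpace ℝ (Fin d))
  metric : MetricSpace carrier
  m : Measure carrier
  measurableSet_ball : ∀ (x : carrier) (r : ℝ), MeasurableSet {y : carrier | metric.dist x y < r}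

namespace IntrinsicDomain

variable {d : ℕ} (S : IntrinsicDomain d)

/-- The intrinsic distance. -/
def dis (x y : S.carrier) : ℝ := S.metric.dist x y

/-- The open ball `B(x, r)` of the intrinsic distance. -/
def ball (x : S.carrier) (r : ℝ) : Set S.carrier := {y | S.dis x y < r}

/-- The measure `w dm`, so that `S.wm w E` is `w(E) = ∫_E w dm` for measurable `E`. -/
def wm (w : S.carrier → ℝ) : Measure S.carrier :=
  S.m.withDensity (fun x => ENNReal.ofReal (w x))

/-- `w` is a nonnegative integrable function satisfying the doubling condition with constant `L`,
that is, `w` is a doubling weight whose (least) doubling constant is at most `L`. -/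
structure IsDoublingWeight (L : ℝ) (w : S.carrier → ℝ) : Prop where
  nonneg : ∀ x, 0 ≤ w x
  integrable : Integrable w S.m
  doubling : ∀ (x : S.carrier) (r : ℝ), 0 < r →
    S.wm w (S.ball x (2 * r)) ≤ ENNReal.ofReal L * S.wm w (S.ball x r)

/-- `Π_n(Ω)`: the restrictions to `Ω` of the real polynomials of total degree at most `n`. -/
def poly (n : ℕ) : Set (S.carrier → ℝ) :=
  {f | ∃ P : MvPolynomial (Fin d) ℝ, P.totalDegree ≤ n ∧
    ∀ x : S.carrier, f x = MvPolynomial.eval (fun i => x.1 i) P}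

/-- The bilinear form `⟨f, g⟩_ϖ = ∫ f g ϖ dm`. -/
def ip (ϖ f g : S.carrier → ℝ) : ℝ := ∫ x, f x * g x * ϖ x ∂S.m

/-- `⟨·,·⟩_ϖ` is a well defined inner product on the space of polynomials restricted to `Ω`. -/
structure IsInnerProductWeight (ϖ : S.carrier → ℝ) : Prop where
  integrable : ∀ n, ∀ f ∈ S.poly n, ∀ g ∈ S.poly n,
    Integrable (fun x => f x * g x * ϖ x) S.m
  definite : ∀ n, ∀ f ∈ S.poly n, S.ip ϖ f f = 0 → f = 0

/-- `V_n(Ω, ϖ)`: the orthogonal polynomials of degree `n`, i.e. the elements of `Π_n(Ω)` that are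
orthogonal to all polynomials of lower degree. -/
def orthoPoly (ϖ : S.carrier → ℝ) (n : ℕ) : Set (S.carrier → ℝ) :=
  {f | f ∈ S.poly n ∧ ∀ k < n, ∀ g ∈ S.poly k, S.ip ϖ f g = 0}

open Classical in
/-- The reproducing kernel `P_n(ϖ; x, y)` of `V_n(Ω, ϖ)`: as a function of `y` it is the (unique)
element of `V_n(Ω, ϖ)` that represents the evaluation at `x`. It exists whenever `⟨·,·⟩_ϖ` is an
inner product on the polynomials. -/
def repKernel (ϖ : S.carrier → ℝ) (n : ℕ) (x y : S.carrier) : ℝ :=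
  if h : ∃ g ∈ S.orthoPoly ϖ n, ∀ f ∈ S.orthoPoly ϖ n, S.ip ϖ f g = f x then h.choose y else 0

/-- `L_n(ϖ; x, y) = ∑_k a(k/n) P_k(ϖ; x, y)`. -/
def locKernel (ϖ : S.carrier → ℝ) (a : ℝ → ℝ) (n : ℕ) (x y : S.carrier) : ℝ :=
  ∑' k : ℕ, a ((k : ℝ) / n) * S.repKernel ϖ k x y

/-- The kernels `L_n(ϖ; ·, ·)`, `n = 1, 2, …`, built with the cut-off function `a`,
are highly localized. -/
structure IsHighlyLocalized (ϖ : S.carrier → ℝ) (a : ℝ → ℝ) : Prop where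
  decay : ∀ κ : ℝ, 0 < κ → ∃ c : ℝ, ∀ n : ℕ, 1 ≤ n → ∀ x y : S.carrier,
    |S.locKernel ϖ a n x y| ≤
      c / (√((S.wm ϖ).real (S.ball x (1 / n))) * √((S.wm ϖ).real (S.ball y (1 / n)))
        * (1 + n * S.dis x y) ^ κ)
  smooth : ∃ δ₀ : ℝ, 0 < δ₀ ∧ δ₀ < 1 ∧ ∀ κ : ℝ, 0 < κ → ∃ c : ℝ, ∀ n : ℕ, 1 ≤ n →
    ∀ δ : ℝ, 0 < δ → δ ≤ δ₀ → ∀ x₁ x₂ y : S.carrier, x₁ ∈ S.ball x₂ (δ / n) →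
    |S.locKernel ϖ a n x₁ y - S.locKernel ϖ a n x₂ y| ≤
      c * (n * S.dis x₁ x₂) /
        (√((S.wm ϖ).real (S.ball x₁ (1 / n))) * √((S.wm ϖ).real (S.ball x₂ (1 / n)))
          * (1 + n * S.dis x₂ y) ^ κ)
  sharp : ∃ κ₀ : ℝ, 0 < κ₀ ∧ ∀ κ : ℝ, κ₀ ≤ κ → ∃ c : ℝ, ∀ n : ℕ, 1 ≤ n → ∀ x : S.carrier,
    ∫⁻ y, ENNReal.ofReal
      (ϖ y / ((S.wm ϖ).real (S.ball y (1 / n)) * (1 + n * S.dis x y) ^ κ)) ∂S.m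
      ≤ ENNReal.ofReal c

/-- `(Ω, ϖ, d)` is a localizable homogeneous space (with respect to the cut-off function `a`):
`ϖ` is a normalized doubling weight, it defines an inner product on polynomials, and it admits
highly localized kernels. -/
structure IsLocalizable (ϖ : S.carrier → ℝ) (a : ℝ → ℝ) : Prop where
  doubling : ∃ L : ℝ, 0 < L ∧ S.IsDoublingWeight L ϖ
  normalized : ∫ x, ϖ x ∂S.m = 1
  innerProduct : S.IsInnerProductWeight ϖ
  localized : S.IsHighlyLocalized ϖ a

/-- `Ξ` is a maximal `ε`-separated subset of `Ω`: distinct points of `Ξ` are at distance at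
least `ε`, and `1 ≤ ∑_{z ∈ Ξ} χ_{B(z, ε)}(x) ≤ c` on `Ω` for some constant `c > 1`. -/
structure IsMaximalSeparated (ε : ℝ) (Ξ : Set S.carrier) : Prop where
  separated : ∀ x ∈ Ξ, ∀ y ∈ Ξ, x ≠ y → ε ≤ S.dis x y
  covering : ∃ c : ℝ, 1 < c ∧ ∀ x : S.carrier,
    1 ≤ ∑' z : Ξ, (S.ball z ε).indicator (1 : S.carrier → ℝ≥0∞) x ∧
    ∑' z : Ξ, (S.ball z ε).indicator (1 : S.carrier → ℝ≥0∞) x ≤ ENNReal.ofReal c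

/-- The (quasi-)norm `‖f‖_{p,w}` of `L^p(Ω, w dm)`, `0 < p < ∞`. -/
def wNorm (p : ℝ) (w f : S.carrier → ℝ) : ℝ≥0∞ :=
  eLpNorm f (ENNReal.ofReal p) (S.wm w)

/-- `(∑_{z ∈ Ξ} (sup_{B(z, ε)} |f|^p) w(B(z, ε)))^{1/p}`. -/
def supSum (p : ℝ) (w : S.carrier → ℝ) (ε : ℝ) (Ξ : Set S.carrier) (f : S.carrier → ℝ) : ℝ≥0∞ :=
  (∑' z : Ξ, (⨆ x ∈ S.ball z ε, ‖f x‖ₑ ^ p) * S.wm w (S.ball z ε)) ^ (1 / p)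

/-- `(∑_{z ∈ Ξ} (inf_{B(z, ε)} |f|^p) w(B(z, ε)))^{1/p}`. -/
def infSum (p : ℝ) (w : S.carrier → ℝ) (ε : ℝ) (Ξ : Set S.carrier) (f : S.carrier → ℝ) : ℝ≥0∞ :=
  (∑' z : Ξ, (⨅ x ∈ S.ball z ε, ‖f x‖ₑ ^ p) * S.wm w (S.ball z ε)) ^ (1 / p)

end IntrinsicDomain

/-- Admissible cut-off functions reproducing polynomials: nonnegative `C^∞` functions on `[0, ∞)`
with support in `[0, 2]` that are equal to `1` on `[0, 1]`. Values on `(-∞, 0)` play no role. -/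
structure IsCutoff (a : ℝ → ℝ) : Prop where
  nonneg : ∀ t, 0 ≤ t → 0 ≤ a t
  smooth : ContDiffOn ℝ ∞ a (Set.Ici 0)
  one : ∀ t, 0 ≤ t → t ≤ 1 → a t = 1
  support : ∀ t, 2 < t → a t = 0

end MZ

end

/-! ### Reproducing kernels of orthogonal polynomials. -/

namespace MZ
namespace IntrinsicDomain

variable {d : ℕ} (S : IntrinsicDomain d)

/-! A polynomial of degree at most `n` is reproduced by `L_n`, so the smoothness of `L_n` limits how
much it can vary at scale `1 / n`. Write `f*(x) = sup_y |f(y)| (1 + n d(x, y))^{-β}` (`peetre`).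
Inserting `|f(y)| ≤ f*(x) (1 + n d(x, y))^β` into the reproducing formula and integrating the
remaining decay against `ϖ` gives an oscillation of at most `C ε f*(x)` on `B(x, ε / n)`
(`exists_enorm_sub_le`).

For small `ε` this bounds `f*` by a weighted supremum of the infima of `|f|` over balls of radius `ε
/ n`, the oscillation term being absorbed (`exists_peetre_le_iSup`). A `p`-th power of a supremum is
at most the sum of the `p`-th powers. When `βp` is large relative to the doubling constant of `w`,
each term integrates to a multiple of `w(B(z, 1 / n))`, hence of the mass of a half ball. The half
balls are disjoint, so `‖f*‖_{p,w} ≤ K ‖f‖_{p,w}`, uniformly in `p ≥ p₀`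
(`exists_lintegral_peetre_le`).

Part (i) follows because the supremum of `|f|` over a ball is dominated by `f*` at every point of
the half ball. For (ii), `|f| ≤ inf |f| + C δ f*` on each ball; for small `δ` the last term is
absorbed into the norm of `f`. Absorption requires finite quantities, which holds because
polynomials are bounded on `Ω`. -/

/-- `S.poly n` as a linear subspace of the functions on `Ω`. -/
noncomputable def polySubmodule (n : ℕ) : Submodule ℝ (S.carrier → ℝ) :=
  (MvPolynomial.restrictTotalDegree (Fin d) ℝ n).map
    (LinearMap.pi fun x : S.carrier => (MvPolynomial.aeval (R := ℝ) (fun i => x.1 i)).toLinearMap)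

instance (n : ℕ) : Module.Finite ℝ (S.polySubmodule n) := by
  unfold polySubmodule; infer_instance

theorem mem_polySubmodule {n : ℕ} {f : S.carrier → ℝ} : f ∈ S.polySubmodule n ↔ f ∈ S.poly n := by
  simp only [polySubmodule, Submodule.mem_map, MvPolynomial.mem_restrictTotalDegree, poly,
    Set.mem_ofPred_eq, funext_iff]
  refine exists_congr fun P => and_congr_right fun _ => forall_congr' fun x => ?_
  simp [MvPolynomial.aeval_eq_eval, eq_comm]

theorem poly_mono {m n : ℕ} (h : m ≤ n) : S.poly m ⊆ S.poly n :=
  fun _ ⟨P, hP, hf⟩ => ⟨P, hP.trans h, hf⟩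

variable {S} {ϖ : S.carrier → ℝ}

theorem ip_comm (f g : S.carrier → ℝ) : S.ip ϖ f g = S.ip ϖ g f := by
  simp only [ip, mul_comm (f _)]

theorem IsInnerProductWeight.ip_add (h : S.IsInnerProductWeight ϖ) {n : ℕ}
    {f g₁ g₂ : S.carrier → ℝ} (hf : f ∈ S.poly n) (h₁ : g₁ ∈ S.poly n) (h₂ : g₂ ∈ S.poly n) :
    S.ip ϖ f (g₁ + g₂) = S.ip ϖ f g₁ + S.ip ϖ f g₂ := by
  rw [ip, ip, ip, ← integral_add (h.integrable n f hf _ h₁) (h.integrable n f hf _ h₂)]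
  exact integral_congr_ae (.of_forall fun x => by simp only [Pi.add_apply]; ring)

theorem ip_smul (c : ℝ) (f g : S.carrier → ℝ) : S.ip ϖ f (c • g) = c * S.ip ϖ f g := by
  rw [ip, ip, ← integral_const_mul]
  exact integral_congr_ae (.of_forall fun x => by simp only [Pi.smul_apply, smul_eq_mul]; ring)

theorem IsInnerProductWeight.ip_sub (h : S.IsInnerProductWeight ϖ) {n : ℕ}
    {f g₁ g₂ : S.carrier → ℝ} (hf : f ∈ S.poly n) (h₁ : g₁ ∈ S.poly n) (h₂ : g₂ ∈ S.poly n) :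
    S.ip ϖ f (g₁ - g₂) = S.ip ϖ f g₁ - S.ip ϖ f g₂ := by
  rw [ip, ip, ip, ← integral_sub (h.integrable n f hf _ h₁) (h.integrable n f hf _ h₂)]
  exact integral_congr_ae (.of_forall fun x => by simp only [Pi.sub_apply]; ring)

/-- The inner product as a bilinear form on a space of polynomials. -/
noncomputable def IsInnerProductWeight.form (h : S.IsInnerProductWeight ϖ) {n : ℕ}
    {W : Submodule ℝ (S.carrier → ℝ)} (hW : W ≤ S.polySubmodule n) : W →ₗ[ℝ] W →ₗ[ℝ] ℝ :=
  have hW' : ∀ f : W, (f : S.carrier → ℝ) ∈ S.poly n := fun f => S.mem_polySubmodule.1 (hW f.2)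
  LinearMap.mk₂ ℝ (fun g f => S.ip ϖ f g)
    (fun g₁ g₂ f => h.ip_add (hW' f) (hW' g₁) (hW' g₂))
    (fun c g f => ip_smul c _ _)
    (fun g f₁ f₂ => by
      simp only [ip_comm _ (g : S.carrier → ℝ)]
      exact h.ip_add (hW' g) (hW' f₁) (hW' f₂))
    (fun c g f => by
      simp only [ip_comm _ (g : S.carrier → ℝ)]
      exact ip_smul c _ _)

/-- Riesz representation on spaces of polynomials. -/
theorem IsInnerProductWeight.exists_representer (h : S.IsInnerProductWeight ϖ) {n : ℕ}
    {W : Submodule ℝ (S.carrier → ℝ)} (hW : W ≤ S.polySubmodule n) (φ : W →ₗ[ℝ] ℝ) :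
    ∃ g ∈ W, ∀ f (hf : f ∈ W), S.ip ϖ f g = φ ⟨f, hf⟩ := by
  have : Module.Finite ℝ W := Submodule.finiteDimensional_of_le hW
  have hinj : Function.Injective (h.form hW) := by
    rw [← LinearMap.ker_eq_bot, LinearMap.ker_eq_bot']
    intro g hg
    have := h.definite n g (S.mem_polySubmodule.1 (hW g.2)) (DFunLike.congr_fun hg g)
    exact Subtype.ext this
  obtain ⟨g, hg⟩ := (LinearMap.injective_iff_surjective_of_finrank_eq_finrank
    (Subspace.dual_finrank_eq (K := ℝ) (V := W)).symm).1 hinj φ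
  exact ⟨g, g.2, fun f hf => DFunLike.congr_fun hg ⟨f, hf⟩⟩

theorem IsInnerProductWeight.exists_mem_orthoPoly (h : S.IsInnerProductWeight ϖ) (n : ℕ)
    (x : S.carrier) : ∃ g ∈ S.orthoPoly ϖ n, ∀ f ∈ S.orthoPoly ϖ n, S.ip ϖ f g = f x := by
  let W : Submodule ℝ (S.carrier → ℝ) :=
    { carrier := S.orthoPoly ϖ n
      zero_mem' := ⟨S.mem_polySubmodule.1 (zero_mem _), fun k _ g _ => by simp [ip]⟩
      add_mem' := fun {f₁ f₂} h₁ h₂ => ⟨S.mem_polySubmodule.1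
        (add_mem (S.mem_polySubmodule.2 h₁.1) (S.mem_polySubmodule.2 h₂.1)), fun k hk g hg => by
          rw [ip_comm, h.ip_add (S.poly_mono hk.le hg) h₁.1 h₂.1, ip_comm, h₁.2 k hk g hg, ip_comm,
            h₂.2 k hk g hg, add_zero]⟩
      smul_mem' := fun c f hf => ⟨S.mem_polySubmodule.1
        (Submodule.smul_mem _ c (S.mem_polySubmodule.2 hf.1)), fun k hk g hg => by
          rw [ip_comm, ip_smul, ip_comm, hf.2 k hk g hg, mul_zero]⟩ }
  have hW : W ≤ S.polySubmodule n := fun f hf => S.mem_polySubmodule.2 hf.1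
  exact h.exists_representer hW ((LinearMap.proj x : (S.carrier → ℝ) →ₗ[ℝ] ℝ) ∘ₗ W.subtype)

theorem IsInnerProductWeight.repKernel_mem (h : S.IsInnerProductWeight ϖ) (n : ℕ)
    (x : S.carrier) : S.repKernel ϖ n x ∈ S.orthoPoly ϖ n := by
  have hex := h.exists_mem_orthoPoly n x
  have : S.repKernel ϖ n x = hex.choose := by
    funext y; rw [repKernel, dif_pos hex]
  rw [this]
  exact hex.choose_spec.1

theorem IsInnerProductWeight.ip_repKernel (h : S.IsInnerProductWeight ϖ) {n : ℕ}
    (x : S.carrier) {f : S.carrier → ℝ} (hf : f ∈ S.orthoPoly ϖ n) :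
    S.ip ϖ f (S.repKernel ϖ n x) = f x := by
  have hex := h.exists_mem_orthoPoly n x
  have : S.repKernel ϖ n x = hex.choose := by
    funext y; rw [repKernel, dif_pos hex]
  rw [this]
  exact hex.choose_spec.2 f hf

theorem IsInnerProductWeight.ip_repKernel_of_lt (h : S.IsInnerProductWeight ϖ) {n k : ℕ}
    (hnk : n < k) (x : S.carrier) {f : S.carrier → ℝ} (hf : f ∈ S.poly n) :
    S.ip ϖ f (S.repKernel ϖ k x) = 0 := by
  rw [ip_comm]
  exact (h.repKernel_mem k x).2 n hnk f hf

/-- A polynomial of degree at most `n` splits into one of lower degree and one in `V_n`. -/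
theorem IsInnerProductWeight.exists_sub_mem_orthoPoly (h : S.IsInnerProductWeight ϖ) {n : ℕ}
    {f : S.carrier → ℝ} (hf : f ∈ S.poly (n + 1)) :
    ∃ g ∈ S.poly n, f - g ∈ S.orthoPoly ϖ (n + 1) := by
  have hle : S.polySubmodule n ≤ S.polySubmodule (n + 1) := fun g hg =>
    S.mem_polySubmodule.2 (S.poly_mono n.le_succ (S.mem_polySubmodule.1 hg))
  -- The representer of `⟨f, ·⟩` on the lower-degree space is the orthogonal projection of `f`.
  let φ : S.polySubmodule n →ₗ[ℝ] ℝ :=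
    (h.form le_rfl ⟨f, S.mem_polySubmodule.2 hf⟩) ∘ₗ Submodule.inclusion hle
  obtain ⟨g, hg, hgφ⟩ := h.exists_representer le_rfl φ
  have hg' := S.poly_mono n.le_succ (S.mem_polySubmodule.1 hg)
  refine ⟨g, S.mem_polySubmodule.1 hg, S.mem_polySubmodule.1 (sub_mem
    (S.mem_polySubmodule.2 hf) (hle hg)), fun k hk u hu => ?_⟩
  have hu' := S.poly_mono (Nat.lt_succ_iff.1 hk) hu
  rw [ip_comm, h.ip_sub (S.poly_mono n.le_succ hu') hf hg',
    hgφ u (S.mem_polySubmodule.2 hu')]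
  exact sub_self _

/-- Induction on the degree along `f = g + (f - g)`: the top kernel sees only `f - g ∈ V_{n+1}` and
reproduces it, while the lower kernels see only `g`. -/
theorem IsInnerProductWeight.sum_ip_repKernel (h : S.IsInnerProductWeight ϖ) (x : S.carrier)
    {n : ℕ} {f : S.carrier → ℝ} (hf : f ∈ S.poly n) :
    ∑ k ∈ Finset.range (n + 1), S.ip ϖ f (S.repKernel ϖ k x) = f x := by
  induction n generalizing f with
  | zero =>
    simpa using h.ip_repKernel x (n := 0) ⟨hf, fun k hk => absurd hk k.not_lt_zero⟩
  | succ n ih =>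
    obtain ⟨g, hg, hfg⟩ := h.exists_sub_mem_orthoPoly hf
    have hg' := S.poly_mono n.le_succ hg
    have key : ∀ k ≤ n + 1, S.ip ϖ f (S.repKernel ϖ k x) =
        S.ip ϖ g (S.repKernel ϖ k x) + S.ip ϖ (f - g) (S.repKernel ϖ k x) := fun k hk => by
      have hk' := S.poly_mono hk (h.repKernel_mem k x).1
      rw [ip_comm (f - g), h.ip_sub hk' hf hg', ip_comm _ f, ip_comm _ g]
      ring
    rw [Finset.sum_range_succ, key _ le_rfl, h.ip_repKernel x hfg,
      h.ip_repKernel_of_lt n.lt_succ_self x hg, Finset.sum_congr rfl fun k hk => ?_, ih hg]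
    · simp
    · have hk' := Finset.mem_range.1 hk
      rw [key k hk'.le, hfg.2 k hk' _ (h.repKernel_mem k x).1, add_zero]

theorem locKernel_eq_sum {a : ℝ → ℝ} (ha : IsCutoff a) {n : ℕ} (hn : 1 ≤ n) (x y : S.carrier) :
    S.locKernel ϖ a n x y =
      ∑ k ∈ Finset.range (2 * n + 1), a ((k : ℝ) / n) * S.repKernel ϖ k x y := by
  -- The cut-off vanishes only for `t > 2`, so the index `k = 2n` has to stay in the sum.
  refine tsum_eq_sum fun k hk => ?_
  have hk' : 2 * n < k := by simpa using hk
  have hn' : (0 : ℝ) < n := by exact_mod_cast hn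
  have : (2 : ℝ) < (k : ℝ) / n := by
    rw [lt_div_iff₀ hn']; exact_mod_cast hk'
  rw [ha.support _ this, zero_mul]

theorem IsInnerProductWeight.locKernel_mem (h : S.IsInnerProductWeight ϖ) {a : ℝ → ℝ}
    (ha : IsCutoff a) {n : ℕ} (hn : 1 ≤ n) (x : S.carrier) :
    S.locKernel ϖ a n x ∈ S.poly (2 * n) := by
  have : S.locKernel ϖ a n x =
      ∑ k ∈ Finset.range (2 * n + 1), a ((k : ℝ) / n) • S.repKernel ϖ k x := by
    funext y; simp [locKernel_eq_sum ha hn]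
  rw [this, ← S.mem_polySubmodule]
  refine sum_mem fun k hk => Submodule.smul_mem _ _ (S.mem_polySubmodule.2 ?_)
  exact S.poly_mono (Nat.lt_succ_iff.1 (Finset.mem_range.1 hk)) (h.repKernel_mem k x).1

/-- The kernel `L_n` reproduces polynomials of degree at most `n`. -/
theorem IsInnerProductWeight.ip_locKernel (h : S.IsInnerProductWeight ϖ) {a : ℝ → ℝ}
    (ha : IsCutoff a) {n : ℕ} (hn : 1 ≤ n) (x : S.carrier) {f : S.carrier → ℝ}
    (hf : f ∈ S.poly n) : S.ip ϖ f (S.locKernel ϖ a n x) = f x := by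
  have hn' : (0 : ℝ) < n := by exact_mod_cast hn
  have hle : n ≤ 2 * n := by omega
  have e : S.ip ϖ f (S.locKernel ϖ a n x) = ∑ k ∈ Finset.range (2 * n + 1),
      a ((k : ℝ) / n) * S.ip ϖ f (S.repKernel ϖ k x) := by
    simp only [← ip_smul]
    simp only [ip]
    rw [← integral_finsetSum]
    · refine integral_congr_ae (.of_forall fun y => ?_)
      simp only [locKernel_eq_sum ha hn, Pi.smul_apply, smul_eq_mul, Finset.mul_sum,
        Finset.sum_mul]
    · intro k hk
      refine h.integrable (2 * n) f (S.poly_mono hle hf) _ (S.mem_polySubmodule.1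
        (Submodule.smul_mem _ _ (S.mem_polySubmodule.2 ?_)))
      exact S.poly_mono (Nat.lt_succ_iff.1 (Finset.mem_range.1 hk)) (h.repKernel_mem k x).1
  rw [e, ← h.sum_ip_repKernel x hf]
  symm
  -- For `k ≤ n` the cut-off equals `1`; for `k > n` the kernel `P_k` is orthogonal to `f`.
  rw [← Finset.sum_subset (Finset.range_mono (Nat.succ_le_succ hle))]
  · refine Finset.sum_congr rfl fun k hk => ?_
    rw [ha.one, one_mul]
    · positivity
    · rw [div_le_one hn']
      exact_mod_cast Nat.lt_succ_iff.1 (Finset.mem_range.1 hk)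
  · intro k _ hk
    rw [h.ip_repKernel_of_lt (by simpa using hk) x hf, mul_zero]

end IntrinsicDomain
end MZ

/-! ### The intrinsic distance and the factor `1 + n d(x, y)`. -/

namespace MZ
namespace IntrinsicDomain

section Distance

variable {d : ℕ} (S : IntrinsicDomain d)

theorem dis_self (x : S.carrier) : S.dis x x = 0 :=
  @dist_self _ S.metric.toPseudoMetricSpace x

theorem dis_comm (x y : S.carrier) : S.dis x y = S.dis y x :=
  @dist_comm _ S.metric.toPseudoMetricSpace x y

theorem dis_triangle (x y z : S.carrier) : S.dis x z ≤ S.dis x y + S.dis y z :=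
  @dist_triangle _ S.metric.toPseudoMetricSpace x y z

theorem dis_nonneg (x y : S.carrier) : 0 ≤ S.dis x y :=
  @dist_nonneg _ S.metric.toPseudoMetricSpace x y

theorem measurableSet_ball' (x : S.carrier) (r : ℝ) : MeasurableSet (S.ball x r) :=
  S.measurableSet_ball x r

theorem mem_ball_self (x : S.carrier) {r : ℝ} (hr : 0 < r) : x ∈ S.ball x r := by
  change S.dis x x < r
  rwa [S.dis_self]

theorem ball_subset_ball {x y : S.carrier} {r s : ℝ} (h : S.dis y x + r ≤ s) :
    S.ball x r ⊆ S.ball y s := fun z (hz : S.dis x z < r) =>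
  lt_of_le_of_lt (S.dis_triangle y x z) (by linarith)

theorem ball_mono (x : S.carrier) {r s : ℝ} (h : r ≤ s) : S.ball x r ⊆ S.ball x s :=
  fun _ hz => lt_of_lt_of_le hz h

theorem measurable_dis (x : S.carrier) : Measurable (S.dis x) :=
  measurable_of_Iio fun r => S.measurableSet_ball x r

/-- The factor `1 + n d(x, y)`. -/
noncomputable def growth (n : ℕ) (x y : S.carrier) : ℝ≥0∞ := ENNReal.ofReal (1 + n * S.dis x y)

theorem measurable_growth (n : ℕ) (x : S.carrier) : Measurable (S.growth n x) := by
  have := S.measurable_dis x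
  unfold growth
  fun_prop

theorem one_le_growth (n : ℕ) (x y : S.carrier) : 1 ≤ S.growth n x y := by
  have := mul_nonneg (Nat.cast_nonneg (α := ℝ) n) (S.dis_nonneg x y)
  rw [growth, ENNReal.one_le_ofReal]
  linarith

theorem growth_ne_zero (n : ℕ) (x y : S.carrier) : S.growth n x y ≠ 0 :=
  (zero_lt_one.trans_le (S.one_le_growth n x y)).ne'

theorem growth_ne_top (n : ℕ) (x y : S.carrier) : S.growth n x y ≠ ⊤ := ENNReal.ofReal_ne_top

theorem growth_comm (n : ℕ) (x y : S.carrier) : S.growth n x y = S.growth n y x := by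
  rw [growth, S.dis_comm, growth]

theorem growth_le_mul (n : ℕ) (x y z : S.carrier) :
    S.growth n x z ≤ S.growth n x y * S.growth n y z := by
  have h₁ := mul_nonneg (Nat.cast_nonneg (α := ℝ) n) (S.dis_nonneg x y)
  have h₂ := mul_nonneg (Nat.cast_nonneg (α := ℝ) n) (S.dis_nonneg y z)
  have h₃ := mul_le_mul_of_nonneg_left (S.dis_triangle x y z) (Nat.cast_nonneg (α := ℝ) n)
  rw [growth, growth, growth, ← ENNReal.ofReal_mul (by linarith)]
  exact ENNReal.ofReal_le_ofReal (by nlinarith [mul_nonneg h₁ h₂])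

theorem growth_rpow_neg_le_one (n : ℕ) (x y : S.carrier) {κ : ℝ} (hκ : 0 ≤ κ) :
    S.growth n x y ^ (-κ) ≤ 1 := by
  rw [ENNReal.rpow_neg, ENNReal.inv_le_one]
  simpa using ENNReal.rpow_le_rpow (S.one_le_growth n x y) hκ

theorem growth_rpow_mul_rpow_neg (n : ℕ) (x y : S.carrier) (κ : ℝ) :
    S.growth n x y ^ κ * S.growth n x y ^ (-κ) = 1 := by
  rw [← ENNReal.rpow_add _ _ (S.growth_ne_zero n x y) (S.growth_ne_top n x y), add_neg_cancel,
    ENNReal.rpow_zero]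

end Distance

/-! ### Consequences of the doubling condition. -/

section Doubling

variable {d : ℕ} {S : IntrinsicDomain d} {w : S.carrier → ℝ} {L : ℝ}

theorem IsDoublingWeight.isFiniteMeasure (hw : S.IsDoublingWeight L w) :
    IsFiniteMeasure (S.wm w) :=
  isFiniteMeasure_withDensity_ofReal hw.integrable.2

theorem IsDoublingWeight.measure_ball_two_pow_le (hw : S.IsDoublingWeight L w) (x : S.carrier)
    {r : ℝ} (hr : 0 < r) (k : ℕ) :
    S.wm w (S.ball x (2 ^ k * r)) ≤ ENNReal.ofReal L ^ k * S.wm w (S.ball x r) := by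
  induction k with
  | zero => simp
  | succ k ih =>
    calc S.wm w (S.ball x (2 ^ (k + 1) * r)) = S.wm w (S.ball x (2 * (2 ^ k * r))) := by ring_nf
      _ ≤ ENNReal.ofReal L * S.wm w (S.ball x (2 ^ k * r)) := hw.doubling x _ (by positivity)
      _ ≤ ENNReal.ofReal L * (ENNReal.ofReal L ^ k * S.wm w (S.ball x r)) := by gcongr
      _ = _ := by ring

theorem IsDoublingWeight.measure_ball_ne_zero (hw : S.IsDoublingWeight L w)
    (h0 : S.wm w Set.univ ≠ 0) (x : S.carrier) {r : ℝ} (hr : 0 < r) :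
    S.wm w (S.ball x r) ≠ 0 := by
  intro h
  refine h0 ?_
  have : Set.univ = ⋃ k : ℕ, S.ball x (2 ^ k * r) := by
    refine (Set.eq_univ_of_forall fun y => Set.mem_iUnion.2 ?_).symm
    obtain ⟨k, hk⟩ := pow_unbounded_of_one_lt (S.dis x y / r) one_lt_two
    exact ⟨k, (div_lt_iff₀ hr).1 hk⟩
  rw [this, measure_iUnion_null_iff]
  intro k
  simpa [h] using hw.measure_ball_two_pow_le x hr k

/-- A space carrying a nontrivial doubling weight is bounded. -/
theorem IsDoublingWeight.exists_dis_lt (hw : S.IsDoublingWeight L w)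
    (h0 : S.wm w Set.univ ≠ 0) : ∃ R : ℝ, ∀ x y : S.carrier, S.dis x y < R := by
  have := hw.isFiniteMeasure
  obtain ⟨x₀, -⟩ := nonempty_of_measure_ne_zero h0
  set η : ℝ≥0∞ := S.wm w (S.ball x₀ 1)
  have hη : η ≠ 0 := hw.measure_ball_ne_zero h0 x₀ one_pos
  by_contra! hR
  have hfar : ∀ r : ℝ, 1 ≤ r → ∃ y, 2 * r ≤ S.dis x₀ y := by
    intro r hr
    obtain ⟨x, y, hxy⟩ := hR (4 * r)
    by_contra! hc
    have := S.dis_triangle x x₀ y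
    rw [S.dis_comm x x₀] at this
    linarith [hc x, hc y]
  -- A far point `y` has a ball that misses `B(x₀, r)` and whose fourfold dilate contains `B(x₀,
  -- 1)`. Two doublings bound `η` by the mass outside `B(x₀, r)`, which tends to `0` since the
  -- measure is finite.
  have hlow : ∀ r : ℝ, 1 ≤ r → η ≤ ENNReal.ofReal L ^ 2 * S.wm w (S.ball x₀ r)ᶜ := by
    intro r hr
    obtain ⟨y, hy⟩ := hfar r hr
    calc η ≤ S.wm w (S.ball y (2 ^ 2 * (S.dis x₀ y / 2))) :=
          measure_mono (S.ball_subset_ball (by rw [S.dis_comm]; linarith))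
      _ ≤ ENNReal.ofReal L ^ 2 * S.wm w (S.ball y (S.dis x₀ y / 2)) :=
          hw.measure_ball_two_pow_le y (by linarith) 2
      _ ≤ _ := by
          gcongr
          intro z (hz : S.dis y z < _) (hz' : S.dis x₀ z < r)
          have := S.dis_triangle x₀ z y
          rw [S.dis_comm z y] at this
          linarith
  have hanti : Antitone fun k : ℕ => (S.ball x₀ (k + 1))ᶜ := fun i j hij =>
    Set.compl_subset_compl.2 (S.ball_mono x₀ (by gcongr))
  have hinter : ⋂ k : ℕ, (S.ball x₀ (k + 1))ᶜ = ∅ := by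
    refine Set.eq_empty_of_forall_notMem fun y hy => ?_
    obtain ⟨k, hk⟩ := exists_nat_gt (S.dis x₀ y)
    exact Set.mem_iInter.1 hy k (show S.dis x₀ y < k + 1 by linarith)
  have ht := tendsto_measure_iInter_atTop (μ := S.wm w) (s := fun k : ℕ => (S.ball x₀ (k + 1))ᶜ)
    (fun k => (S.measurableSet_ball' _ _).compl.nullMeasurableSet) hanti ⟨0, measure_ne_top _ _⟩
  rw [hinter, measure_empty] at ht
  have ht' := ENNReal.Tendsto.const_mul (a := ENNReal.ofReal L ^ 2) ht
    (Or.inr (ENNReal.pow_ne_top ENNReal.ofReal_ne_top))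
  rw [mul_zero] at ht'
  exact hη (le_zero_iff.1 (ge_of_tendsto' ht' fun k => hlow _ (by simp)))

/-- As the space is bounded, a fixed number of doublings turns any ball of radius `r` into all of
`Ω`, whatever its centre. -/
theorem IsDoublingWeight.exists_le_measure_ball (hw : S.IsDoublingWeight L w)
    (h0 : S.wm w Set.univ ≠ 0) {r : ℝ} (hr : 0 < r) :
    ∃ b : ℝ, 0 < b ∧ ∀ x, b ≤ (S.wm w).real (S.ball x r) := by
  have := hw.isFiniteMeasure
  obtain ⟨R, hR⟩ := hw.exists_dis_lt h0
  obtain ⟨k, hk⟩ := pow_unbounded_of_one_lt (R / r) one_lt_two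
  have hk' : ∀ x, S.wm w Set.univ ≤ ENNReal.ofReal L ^ k * S.wm w (S.ball x r) := fun x =>
    (measure_mono fun y _ => (hR x y).trans ((div_lt_iff₀ hr).1 hk)).trans
      (hw.measure_ball_two_pow_le x hr k)
  refine ⟨(S.wm w Set.univ / ENNReal.ofReal L ^ k).toReal, ENNReal.toReal_pos ?_ ?_, fun x => ?_⟩
  · exact ENNReal.div_ne_zero.2 ⟨h0, ENNReal.pow_ne_top ENNReal.ofReal_ne_top⟩
  · obtain ⟨x₀, -⟩ := nonempty_of_measure_ne_zero h0
    refine ENNReal.div_ne_top (measure_ne_top _ _) fun hL => h0 ?_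
    simpa [hL] using hk' x₀
  · exact ENNReal.toReal_mono (measure_ne_top _ _) (ENNReal.div_le_of_le_mul' (hk' x))

theorem exists_two_mul_le_two_rpow (L : ℝ) : ∃ κ : ℝ, 0 < κ ∧ 2 * ENNReal.ofReal L ≤ 2 ^ κ := by
  obtain ⟨k, hk⟩ := pow_unbounded_of_one_lt (2 * L) one_lt_two
  -- The extra `1` only makes the exponent positive.
  refine ⟨k + 1, by positivity, ?_⟩
  calc 2 * ENNReal.ofReal L = ENNReal.ofReal (2 * L) := by
        rw [ENNReal.ofReal_mul two_pos.le, ENNReal.ofReal_ofNat]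
    _ ≤ ENNReal.ofReal (2 ^ (k + 1)) := ENNReal.ofReal_le_ofReal
        (hk.le.trans (pow_le_pow_right₀ one_le_two k.le_succ))
    _ = 2 ^ (k + 1 : ℝ) := by
        rw [ENNReal.ofReal_pow two_pos.le, ENNReal.ofReal_ofNat, ← ENNReal.rpow_natCast]
        push_cast
        rfl

/-- Integration of `(1 + n d(x, ·))^{-κ}` against a doubling weight. -/
theorem IsDoublingWeight.lintegral_growth_rpow_neg_le (hw : S.IsDoublingWeight L w) {κ : ℝ}
    (hκ : 0 < κ) (hL : 2 * ENNReal.ofReal L ≤ 2 ^ κ) {n : ℕ} (hn : 1 ≤ n) (x : S.carrier) :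
    ∫⁻ y, S.growth n x y ^ (-κ) ∂S.wm w ≤ 2 ^ κ * 2 * S.wm w (S.ball x (1 / n)) := by
  have hn' : (0 : ℝ) < n := by exact_mod_cast hn
  set q : ℝ≥0∞ := 2 ^ (-κ)
  have hq : q * 2 ^ κ = 1 := by
    rw [← ENNReal.rpow_add _ _ two_ne_zero ENNReal.ofNat_ne_top, neg_add_cancel,
      ENNReal.rpow_zero]
  have hqL : q * ENNReal.ofReal L ≤ 2⁻¹ := by
    rw [ENNReal.le_inv_iff_mul_le]
    calc q * ENNReal.ofReal L * 2 = q * (2 * ENNReal.ofReal L) := by ring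
      _ ≤ q * 2 ^ κ := by gcongr
      _ = 1 := hq
  -- With `k` least such that `n d(x, y) < 2^k`, one has `2^k ≤ 2 (1 + n d(x, y))`, so the single
  -- term of index `k` suffices. Each doubling then costs `L` against a gain `q = 2^{-κ}`, and `qL ≤
  -- 1/2` gives a geometric series.
  have hpt : ∀ y, S.growth n x y ^ (-κ) ≤
      ∑' k : ℕ, (S.ball x (2 ^ k * (1 / n))).indicator (fun _ => 2 ^ κ * q ^ k) y := by
    intro y
    have hex : ∃ k : ℕ, n * S.dis x y < 2 ^ k := pow_unbounded_of_one_lt _ one_lt_two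
    classical
    set k := Nat.find hex
    have hk : n * S.dis x y < 2 ^ k := Nat.find_spec hex
    have hle : (2 : ℝ≥0∞) ^ k ≤ 2 * S.growth n x y := by
      have h1 := mul_nonneg hn'.le (S.dis_nonneg x y)
      have : (2 : ℝ) ^ k ≤ 2 * (1 + n * S.dis x y) := by
        rcases hk0 : k with _ | j
        · simp only [pow_zero]; linarith
        · have := Nat.find_min hex (m := j) (by omega)
          rw [pow_succ]
          linarith
      have := ENNReal.ofReal_le_ofReal this
      rwa [ENNReal.ofReal_pow two_pos.le, ENNReal.ofReal_mul two_pos.le,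
        ENNReal.ofReal_ofNat] at this
    refine le_trans ?_ (ENNReal.le_tsum k)
    have hmem : y ∈ S.ball x (2 ^ k * (1 / n)) := by
      change S.dis x y < _
      rw [mul_one_div, lt_div_iff₀ hn']
      linarith
    rw [Set.indicator_of_mem hmem]
    calc S.growth n x y ^ (-κ)
        = (q * 2 ^ κ) ^ k * S.growth n x y ^ (-κ) := by rw [hq, one_pow, one_mul]
      _ = q ^ k * ((2 : ℝ≥0∞) ^ k) ^ κ * S.growth n x y ^ (-κ) := by
          rw [mul_pow, ← ENNReal.rpow_mul_natCast 2 κ k, mul_comm κ, ENNReal.rpow_natCast_mul]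
      _ ≤ q ^ k * (2 * S.growth n x y) ^ κ * S.growth n x y ^ (-κ) := by gcongr
      _ = 2 ^ κ * q ^ k * (S.growth n x y ^ κ * S.growth n x y ^ (-κ)) := by
          rw [ENNReal.mul_rpow_of_nonneg _ _ hκ.le]; ring
      _ = 2 ^ κ * q ^ k := by rw [S.growth_rpow_mul_rpow_neg, mul_one]
  calc ∫⁻ y, S.growth n x y ^ (-κ) ∂S.wm w
      ≤ ∫⁻ y, ∑' k : ℕ, (S.ball x (2 ^ k * (1 / n))).indicator (fun _ => 2 ^ κ * q ^ k) y
          ∂S.wm w := lintegral_mono hpt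
    _ = ∑' k : ℕ, 2 ^ κ * q ^ k * S.wm w (S.ball x (2 ^ k * (1 / n))) := by
        rw [lintegral_tsum fun k => (measurable_const.indicator
          (S.measurableSet_ball' _ _)).aemeasurable]
        simp only [lintegral_indicator_const (S.measurableSet_ball' _ _)]
    _ ≤ ∑' k : ℕ, 2 ^ κ * S.wm w (S.ball x (1 / n)) * 2⁻¹ ^ k := by
        refine ENNReal.tsum_le_tsum fun k => ?_
        calc 2 ^ κ * q ^ k * S.wm w (S.ball x (2 ^ k * (1 / n)))
            ≤ 2 ^ κ * q ^ k * (ENNReal.ofReal L ^ k * S.wm w (S.ball x (1 / n))) := by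
              gcongr
              exact hw.measure_ball_two_pow_le x (by positivity) k
          _ = 2 ^ κ * S.wm w (S.ball x (1 / n)) * (q * ENNReal.ofReal L) ^ k := by
              rw [mul_pow]; ring
          _ ≤ _ := by gcongr
    _ = 2 ^ κ * 2 * S.wm w (S.ball x (1 / n)) := by
        rw [ENNReal.tsum_mul_left, ENNReal.tsum_geometric, ENNReal.one_sub_inv_two, inv_inv]
        ring

end Doubling

/-! ### Separated sets and their disjoint half balls. -/

section Separated

variable {d : ℕ} {S : IntrinsicDomain d} {w : S.carrier → ℝ} {L : ℝ}

/-- A separated set that is maximal under inclusion covers. The alternative `x = z` is there because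
`ε` may have any sign, so a point need not lie in its own ball. -/
theorem exists_separated_cover (S : IntrinsicDomain d) (ε : ℝ) : ∃ Ξ : Set S.carrier,
    (∀ x ∈ Ξ, ∀ y ∈ Ξ, x ≠ y → ε ≤ S.dis x y) ∧ ∀ x, ∃ z ∈ Ξ, x = z ∨ S.dis z x < ε := by
  obtain ⟨Ξ, hΞ⟩ := zorn_subset
    {Ξ : Set S.carrier | ∀ x ∈ Ξ, ∀ y ∈ Ξ, x ≠ y → ε ≤ S.dis x y} fun c hc hchain => by
      refine ⟨⋃₀ c, ?_, fun s hs => Set.subset_sUnion_of_mem hs⟩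
      rintro x ⟨s, hs, hx⟩ y ⟨t, ht, hy⟩ hxy
      rcases hchain.total hs ht with hst | hst
      · exact hc ht x (hst hx) y hy hxy
      · exact hc hs x hx y (hst hy) hxy
  refine ⟨Ξ, hΞ.prop, fun x => ?_⟩
  by_contra! hx
  have hmem : x ∈ Ξ := hΞ.mem_of_prop_insert (x := x) <| by
    rintro y (rfl | hy) z (rfl | hz) hyz
    · exact absurd rfl hyz
    · rw [S.dis_comm]; exact (hx z hz).2
    · exact (hx y hy).2
    · exact hΞ.prop y hy z hz hyz
  exact (hx x hmem).1 rfl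

theorem disjoint_half_balls {ε : ℝ} {Ξ : Set S.carrier}
    (hΞ : ∀ x ∈ Ξ, ∀ y ∈ Ξ, x ≠ y → ε ≤ S.dis x y) :
    Pairwise (Function.onFun Disjoint fun z : Ξ => S.ball z (ε / 2)) := by
  intro x y hxy
  refine Set.disjoint_left.2 fun z (hx : S.dis x z < _) (hy : S.dis y z < _) => ?_
  have h := hΞ x x.2 y y.2 fun h => hxy (Subtype.ext h)
  have := S.dis_triangle x z y
  rw [S.dis_comm z y] at this
  linarith

theorem IsDoublingWeight.countable_of_separated (hw : S.IsDoublingWeight L w)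
    (h0 : S.wm w Set.univ ≠ 0) {ε : ℝ} (hε : 0 < ε) {Ξ : Set S.carrier}
    (hΞ : ∀ x ∈ Ξ, ∀ y ∈ Ξ, x ≠ y → ε ≤ S.dis x y) : Countable Ξ := by
  have := hw.isFiniteMeasure
  have h := Measure.countable_meas_pos_of_disjoint_iUnion (μ := S.wm w)
    (As := fun z : Ξ => S.ball z (ε / 2)) (fun z => S.measurableSet_ball' _ _)
    (disjoint_half_balls hΞ)
  rw [← Set.countable_univ_iff]
  convert h
  refine (Set.eq_univ_of_forall fun z => ?_).symm
  exact pos_iff_ne_zero.2 (hw.measure_ball_ne_zero h0 z (half_pos hε))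

theorem tsum_lintegral_half_balls_le {ε : ℝ} {Ξ : Set S.carrier} [Countable Ξ]
    (hΞ : ∀ x ∈ Ξ, ∀ y ∈ Ξ, x ≠ y → ε ≤ S.dis x y) (μ : Measure S.carrier)
    (g : S.carrier → ℝ≥0∞) : ∑' z : Ξ, ∫⁻ x in S.ball z (ε / 2), g x ∂μ ≤ ∫⁻ x, g x ∂μ := by
  rw [← lintegral_iUnion (fun z => S.measurableSet_ball' _ _) (disjoint_half_balls hΞ)]
  exact setLIntegral_le_lintegral _ _

theorem IsMaximalSeparated.exists_mem_ball {ε : ℝ} {Ξ : Set S.carrier}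
    (h : S.IsMaximalSeparated ε Ξ) (x : S.carrier) : ∃ z ∈ Ξ, x ∈ S.ball z ε := by
  obtain ⟨c, -, hc⟩ := h.covering
  by_contra! hx
  have := (hc x).1
  rw [ENNReal.tsum_eq_zero.2 fun z : Ξ => Set.indicator_of_notMem (hx z z.2) _] at this
  simp at this

end Separated

end IntrinsicDomain
end MZ

/-! ### The Peetre maximal function and the oscillation of polynomials. -/

namespace MZ
namespace IntrinsicDomain

variable {d : ℕ} {S : IntrinsicDomain d} {ϖ : S.carrier → ℝ} {a : ℝ → ℝ}

/-- The Peetre type maximal function `sup_y |f(y)| (1 + n d(x, y))^{-β}`. -/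
noncomputable def peetre (S : IntrinsicDomain d) (β : ℝ) (n : ℕ) (f : S.carrier → ℝ)
    (x : S.carrier) : ℝ≥0∞ :=
  ⨆ y, ‖f y‖ₑ * S.growth n x y ^ (-β)

theorem enorm_le_peetre_mul (β : ℝ) (n : ℕ) (f : S.carrier → ℝ) (x y : S.carrier) :
    ‖f y‖ₑ ≤ S.peetre β n f x * S.growth n x y ^ β := by
  have h : ‖f y‖ₑ * S.growth n x y ^ (-β) ≤ S.peetre β n f x :=
    le_iSup (fun y => ‖f y‖ₑ * S.growth n x y ^ (-β)) y
  calc ‖f y‖ₑ = ‖f y‖ₑ * (S.growth n x y ^ β * S.growth n x y ^ (-β)) := by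
        rw [S.growth_rpow_mul_rpow_neg, mul_one]
    _ = ‖f y‖ₑ * S.growth n x y ^ (-β) * S.growth n x y ^ β := by ring
    _ ≤ _ := by gcongr

theorem peetre_le {β : ℝ} (hβ : 0 ≤ β) (n : ℕ) {f : S.carrier → ℝ} {M : ℝ≥0∞}
    (hM : ∀ y, ‖f y‖ₑ ≤ M) (x : S.carrier) : S.peetre β n f x ≤ M :=
  iSup_le fun y => (mul_le_of_le_one_right' (S.growth_rpow_neg_le_one n x y hβ)).trans (hM y)

theorem growth_rpow_neg_le_mul {β : ℝ} (hβ : 0 ≤ β) (n : ℕ) (x y z : S.carrier) :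
    S.growth n x y ^ (-β) ≤ S.growth n y z ^ β * S.growth n x z ^ (-β) := by
  calc S.growth n x y ^ (-β)
      = S.growth n x y ^ (-β) * (S.growth n x z ^ β * S.growth n x z ^ (-β)) := by
        rw [S.growth_rpow_mul_rpow_neg, mul_one]
    _ ≤ S.growth n x y ^ (-β) *
        ((S.growth n x y * S.growth n y z) ^ β * S.growth n x z ^ (-β)) := by
        gcongr; exact S.growth_le_mul n x y z
    _ = S.growth n x y ^ β * S.growth n x y ^ (-β) *
        (S.growth n y z ^ β * S.growth n x z ^ (-β)) := by
        rw [ENNReal.mul_rpow_of_nonneg _ _ hβ]; ring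
    _ = _ := by rw [S.growth_rpow_mul_rpow_neg, one_mul]

/-- By the triangle inequality, moving the base point costs only a power of the growth factor; this
is what allows absorption at a different point. -/
theorem peetre_le_mul {β : ℝ} (hβ : 0 ≤ β) (n : ℕ) (f : S.carrier → ℝ) (x y : S.carrier) :
    S.peetre β n f y ≤ S.peetre β n f x * S.growth n x y ^ β := by
  refine iSup_le fun u => ?_
  calc ‖f u‖ₑ * S.growth n y u ^ (-β)
      ≤ ‖f u‖ₑ * (S.growth n y x ^ β * S.growth n u x ^ (-β)) := by
        rw [S.growth_comm n y u]
        gcongr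
        exact growth_rpow_neg_le_mul hβ n u y x
    _ = ‖f u‖ₑ * S.growth n x u ^ (-β) * S.growth n x y ^ β := by
        rw [S.growth_comm n y x, S.growth_comm n u x]; ring
    _ ≤ _ := by
        gcongr
        exact le_iSup (fun u => ‖f u‖ₑ * S.growth n x u ^ (-β)) u

theorem IsLocalizable.measure_univ_ne_zero (hS : S.IsLocalizable ϖ a) :
    S.wm ϖ Set.univ ≠ 0 := by
  obtain ⟨L, -, hL⟩ := hS.doubling
  have : S.wm ϖ Set.univ = 1 := by
    rw [wm, withDensity_apply _ MeasurableSet.univ, Measure.restrict_univ,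
      ← ofReal_integral_eq_lintegral_ofReal hL.integrable (.of_forall hL.nonneg),
      hS.normalized, ENNReal.ofReal_one]
  simp [this]

/-- Polynomials are bounded on a localizable space. -/
theorem IsLocalizable.exists_enorm_le (hS : S.IsLocalizable ϖ a) (ha : IsCutoff a) {n : ℕ}
    (hn : 1 ≤ n) {f : S.carrier → ℝ} (hf : f ∈ S.poly n) : ∃ M : ℝ≥0∞, M ≠ ⊤ ∧
      ∀ x, ‖f x‖ₑ ≤ M := by
  obtain ⟨L, -, hL⟩ := hS.doubling
  obtain ⟨b, hb, hball⟩ := hL.exists_le_measure_ball hS.measure_univ_ne_zero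
    (r := 1 / n) (by have : (0 : ℝ) < n := by exact_mod_cast hn
                     positivity)
  -- Any exponent would do: only boundedness of the kernel for fixed `n` is needed. The bound on `f`
  -- is not uniform in `n` and serves only as a finiteness statement.
  obtain ⟨c, hc⟩ := hS.localized.decay 1 one_pos
  have hker : ∀ x y, |S.locKernel ϖ a n x y| ≤ |c| / b := by
    intro x y
    refine (hc n hn x y).trans (div_le_div₀ (abs_nonneg c) (le_abs_self c) hb ?_)
    have h1 : (1 : ℝ) ≤ (1 + n * S.dis x y) ^ (1 : ℝ) := by
      rw [Real.rpow_one]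
      exact le_add_of_nonneg_right (mul_nonneg (Nat.cast_nonneg _) (S.dis_nonneg x y))
    calc b = √b * √b * 1 := by rw [Real.mul_self_sqrt hb.le, mul_one]
      _ ≤ _ := by
        gcongr
        · exact hball x
        · exact hball y
  have hone : (1 : S.carrier → ℝ) ∈ S.poly n := ⟨1, by simp, fun x => by simp⟩
  have hint := ((hS.innerProduct.integrable n f hf 1 hone).norm.mul_const (|c| / b))
  refine ⟨ENNReal.ofReal (∫ y, ‖f y * (1 : S.carrier → ℝ) y * ϖ y‖ * (|c| / b) ∂S.m),
    ENNReal.ofReal_ne_top, fun x => ?_⟩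
  rw [← ofReal_norm]
  refine ENNReal.ofReal_le_ofReal ?_
  rw [← hS.innerProduct.ip_locKernel ha hn x hf]
  refine norm_integral_le_of_norm_le hint (.of_forall fun y => ?_)
  simp only [norm_mul, Real.norm_eq_abs, Pi.one_apply, mul_one]
  calc |f y| * |S.locKernel ϖ a n x y| * |ϖ y| ≤ |f y| * (|c| / b) * |ϖ y| := by
        gcongr; exact hker x y
    _ = _ := by ring

/-- Since `d(x₁, x₂) ≤ 1 / n`, the ball about `x₂` lies in the doubled ball about `x₁`. Doubling
replaces the geometric mean of the two masses by the mass at `x₂` alone, at the price of `√L`. -/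
theorem enorm_locKernel_sub_le {L c ε κ : ℝ} (hL : S.IsDoublingWeight L ϖ)
    (h0 : S.wm ϖ Set.univ ≠ 0) {n : ℕ} (hn : 1 ≤ n) {x₁ x₂ y : S.carrier} (hε : 0 < ε)
    (hε1 : ε ≤ 1) (hx : x₁ ∈ S.ball x₂ (ε / n))
    (h : |S.locKernel ϖ a n x₁ y - S.locKernel ϖ a n x₂ y| ≤ c * (n * S.dis x₁ x₂) /
        (√((S.wm ϖ).real (S.ball x₁ (1 / n))) * √((S.wm ϖ).real (S.ball x₂ (1 / n)))
          * (1 + n * S.dis x₂ y) ^ κ)) :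
    ‖S.locKernel ϖ a n x₁ y - S.locKernel ϖ a n x₂ y‖ₑ ≤
      ENNReal.ofReal (|c| * √L * ε) / S.wm ϖ (S.ball x₂ (1 / n)) * S.growth n x₂ y ^ (-κ) := by
  have := hL.isFiniteMeasure
  have hn' : (0 : ℝ) < n := by exact_mod_cast hn
  have hr : (0 : ℝ) < 1 / n := by positivity
  have hd : n * S.dis x₁ x₂ ≤ ε := by
    have h : S.dis x₂ x₁ < ε / n := hx
    rw [lt_div_iff₀ hn'] at h
    rw [S.dis_comm]; linarith
  set A := (S.wm ϖ).real (S.ball x₁ (1 / n))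
  set B := (S.wm ϖ).real (S.ball x₂ (1 / n)) with hB
  have hA0 : 0 < A := ENNReal.toReal_pos (hL.measure_ball_ne_zero h0 x₁ hr) (measure_ne_top _ _)
  have hB0 : 0 < B := ENNReal.toReal_pos (hL.measure_ball_ne_zero h0 x₂ hr) (measure_ne_top _ _)
  have hBA' : S.wm ϖ (S.ball x₂ (1 / n)) ≤ ENNReal.ofReal L * S.wm ϖ (S.ball x₁ (1 / n)) := by
    refine (measure_mono (S.ball_subset_ball ?_)).trans (hL.doubling x₁ _ hr)
    have : S.dis x₁ x₂ ≤ 1 / n := by rw [le_div_iff₀ hn']; linarith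
    linarith
  have hL0 : 0 < L := by
    by_contra! hL0
    rw [ENNReal.ofReal_of_nonpos hL0, zero_mul, nonpos_iff_eq_zero] at hBA'
    exact hL.measure_ball_ne_zero h0 x₂ hr hBA'
  have hBA : B ≤ L * A := by
    have := ENNReal.toReal_mono (ENNReal.mul_ne_top ENNReal.ofReal_ne_top (measure_ne_top _ _)) hBA'
    rwa [ENNReal.toReal_mul, ENNReal.toReal_ofReal hL0.le] at this
  have hg : 0 < 1 + n * S.dis x₂ y :=
    add_pos_of_pos_of_nonneg one_pos (mul_nonneg hn'.le (S.dis_nonneg _ _))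
  have hreal : |S.locKernel ϖ a n x₁ y - S.locKernel ϖ a n x₂ y| ≤
      |c| * √L * ε / B * (1 + n * S.dis x₂ y) ^ (-κ) := by
    refine h.trans ?_
    rw [Real.rpow_neg hg.le, ← div_eq_mul_inv, div_div]
    have hgκ := Real.rpow_pos_of_pos hg κ
    have hsq : B ≤ √L * (√A * √B) := by
      calc B = √B * √B := (Real.mul_self_sqrt hB0.le).symm
        _ ≤ √(L * A) * √B := by gcongr
        _ = _ := by rw [Real.sqrt_mul hL0.le]; ring
    rw [div_le_div_iff₀ (by positivity) (by positivity)]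
    calc c * (n * S.dis x₁ x₂) * (B * (1 + n * S.dis x₂ y) ^ κ)
        ≤ |c| * ε * (√L * (√A * √B) * (1 + n * S.dis x₂ y) ^ κ) := by
          have := mul_nonneg hn'.le (S.dis_nonneg x₁ x₂)
          gcongr
          exact le_abs_self c
      _ = _ := by ring
  rw [← ofReal_norm, Real.norm_eq_abs]
  refine (ENNReal.ofReal_le_ofReal hreal).trans_eq ?_
  rw [ENNReal.ofReal_mul (by positivity), ENNReal.ofReal_div_of_pos hB0, hB, ofReal_measureReal,
    ← ENNReal.ofReal_rpow_of_pos hg, growth]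

/-- The oscillation of a polynomial of degree `n` at scale `ε / n`. -/
theorem IsLocalizable.exists_enorm_sub_le (hS : S.IsLocalizable ϖ a) (ha : IsCutoff a) :
    ∃ δ₀ : ℝ, 0 < δ₀ ∧ ∀ β : ℝ, 0 < β → ∃ C : ℝ, 0 < C ∧ ∀ n : ℕ, 1 ≤ n →
      ∀ f ∈ S.poly n, ∀ ε : ℝ, 0 < ε → ε ≤ δ₀ → ∀ x₁ x₂ : S.carrier, x₁ ∈ S.ball x₂ (ε / n) →
        ‖f x₁ - f x₂‖ₑ ≤ ENNReal.ofReal (C * ε) * S.peetre β n f x₂ := by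
  obtain ⟨L, hLpos, hL⟩ := hS.doubling
  have := hL.isFiniteMeasure
  have h0 := hS.measure_univ_ne_zero
  obtain ⟨δ₀, hδ₀, hδ₁, hsmooth⟩ := hS.localized.smooth
  obtain ⟨κ, hκ, hLκ⟩ := exists_two_mul_le_two_rpow L
  refine ⟨δ₀, hδ₀, fun β hβ => ?_⟩
  -- The exponent `β` pays for the growth allowed by `peetre`, and `κ` makes the rest integrable
  -- against `ϖ`.
  obtain ⟨c, hc⟩ := hsmooth (β + κ) (by positivity)
  refine ⟨(|c| + 1) * √L * (2 ^ κ * 2), by positivity, fun n hn f hf ε hε hεδ x₁ x₂ hx => ?_⟩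
  have hn' : (0 : ℝ) < n := by exact_mod_cast hn
  set K : ℝ≥0∞ := ENNReal.ofReal (|c| * √L * ε) / S.wm ϖ (S.ball x₂ (1 / n)) with hK
  have hrep : f x₁ - f x₂ = ∫ y, f y * (S.locKernel ϖ a n x₁ y - S.locKernel ϖ a n x₂ y) * ϖ y
      ∂S.m := by
    rw [← hS.innerProduct.ip_locKernel ha hn x₁ hf, ← hS.innerProduct.ip_locKernel ha hn x₂ hf,
      ← hS.innerProduct.ip_sub (S.poly_mono (by omega : n ≤ 2 * n) hf)
        (hS.innerProduct.locKernel_mem ha hn x₁) (hS.innerProduct.locKernel_mem ha hn x₂)]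
    rfl
  calc ‖f x₁ - f x₂‖ₑ
      ≤ ∫⁻ y, ‖f y * (S.locKernel ϖ a n x₁ y - S.locKernel ϖ a n x₂ y) * ϖ y‖ₑ ∂S.m := by
        rw [hrep]; exact enorm_integral_le_lintegral_enorm _
    _ ≤ ∫⁻ y, ENNReal.ofReal (ϖ y) * (S.peetre β n f x₂ * K * S.growth n x₂ y ^ (-κ)) ∂S.m := by
        refine lintegral_mono fun y => ?_
        simp only [enorm_mul]
        have h₁ := enorm_le_peetre_mul β n f x₂ y
        have h₂ := enorm_locKernel_sub_le (y := y) hL h0 hn hε (hεδ.trans hδ₁.le) hx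
          (hc n hn ε hε hεδ x₁ x₂ y hx)
        rw [Real.enorm_of_nonneg (hL.nonneg y)]
        calc _ ≤ S.peetre β n f x₂ * S.growth n x₂ y ^ β *
              (K * S.growth n x₂ y ^ (-(β + κ))) * ENNReal.ofReal (ϖ y) := by gcongr
          _ = ENNReal.ofReal (ϖ y) * (S.peetre β n f x₂ * K *
              (S.growth n x₂ y ^ β * S.growth n x₂ y ^ (-β) * S.growth n x₂ y ^ (-κ))) := by
              rw [neg_add, ENNReal.rpow_add _ _ (S.growth_ne_zero _ _ _) (S.growth_ne_top _ _ _)]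
              ring
          _ = _ := by rw [S.growth_rpow_mul_rpow_neg, one_mul]
    _ = ∫⁻ y, S.peetre β n f x₂ * K * S.growth n x₂ y ^ (-κ) ∂S.wm ϖ := by
        have hm : Measurable fun y => S.growth n x₂ y ^ (-κ) :=
          (S.measurable_growth n x₂).pow_const _
        rw [wm, lintegral_withDensity_eq_lintegral_mul₀ hL.integrable.aemeasurable.ennreal_ofReal
          (hm.const_mul _).aemeasurable]
        rfl
    _ = S.peetre β n f x₂ * K * ∫⁻ y, S.growth n x₂ y ^ (-κ) ∂S.wm ϖ :=
        lintegral_const_mul _ ((S.measurable_growth n x₂).pow_const _)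
    _ ≤ S.peetre β n f x₂ * K * (2 ^ κ * 2 * S.wm ϖ (S.ball x₂ (1 / n))) := by
        gcongr
        exact hL.lintegral_growth_rpow_neg_le hκ hLκ hn x₂
    _ = 2 ^ κ * 2 * ENNReal.ofReal (|c| * √L * ε) * S.peetre β n f x₂ := by
        have : K * S.wm ϖ (S.ball x₂ (1 / n)) = ENNReal.ofReal (|c| * √L * ε) :=
          ENNReal.div_mul_cancel (hL.measure_ball_ne_zero h0 x₂ (by positivity))
            (measure_ne_top _ _)
        rw [← this]; ring
    _ ≤ _ := by
        gcongr
        have h2 : (2 : ℝ≥0∞) ^ κ * 2 = ENNReal.ofReal (2 ^ κ * 2) := by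
          rw [ENNReal.ofReal_mul (by positivity), ← ENNReal.ofReal_rpow_of_pos two_pos,
            ENNReal.ofReal_ofNat]
        rw [h2, ← ENNReal.ofReal_mul (by positivity)]
        refine ENNReal.ofReal_le_ofReal ?_
        have : 0 ≤ 2 ^ κ * 2 * (√L * ε) := by positivity
        nlinarith [abs_nonneg c]

end IntrinsicDomain
end MZ

/-! ### Inequalities for powers in `ℝ≥0∞`, with constants suited to all `p ≥ p₀`. -/

namespace MZ

section ENNReal

theorem le_two_mul_of_le_add_half {X A : ℝ≥0∞} (hX : X ≠ ⊤) (h : X ≤ A + 2⁻¹ * X) :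
    X ≤ 2 * A := by
  have hfin : 2⁻¹ * X ≠ ⊤ := ENNReal.mul_ne_top (by simp) hX
  have hsplit : X = 2⁻¹ * X + 2⁻¹ * X := by
    rw [← add_mul, ENNReal.inv_two_add_inv_two, one_mul]
  have h' : 2⁻¹ * X ≤ A := by
    rw [← ENNReal.add_le_add_iff_right hfin, ← hsplit]
    exact h
  calc X = 2 * (2⁻¹ * X) := by rw [two_mul]; exact hsplit
    _ ≤ 2 * A := by gcongr

theorem add_rpow_le_two_rpow_mul (x y : ℝ≥0∞) {p : ℝ} (hp : 0 ≤ p) :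
    (x + y) ^ p ≤ 2 ^ p * (x ^ p + y ^ p) := by
  calc (x + y) ^ p ≤ (2 * max x y) ^ p := by
        gcongr
        rw [two_mul]
        exact add_le_add (le_max_left _ _) (le_max_right _ _)
    _ = 2 ^ p * max (x ^ p) (y ^ p) := by
        rw [ENNReal.mul_rpow_of_nonneg _ _ hp, ENNReal.max_rpow hp]
    _ ≤ _ := by
        gcongr
        exact max_le le_self_add le_add_self

/-- Turns a constant independent of `p` into a `p`-th power, so that it stays bounded for `p ≥ p₀`
after taking `p`-th roots. -/
theorem le_max_one_rpow_rpow (M : ℝ≥0∞) {p₀ p : ℝ} (hp₀ : 0 < p₀) (hp : p₀ ≤ p) :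
    M ≤ (max M 1 ^ (1 / p₀)) ^ p := by
  rw [← ENNReal.rpow_mul]
  calc M ≤ max M 1 := le_max_left _ _
    _ = max M 1 ^ (1 : ℝ) := (ENNReal.rpow_one _).symm
    _ ≤ _ := ENNReal.rpow_le_rpow_of_exponent_le (le_max_right _ _) (by
        rw [one_div, inv_mul_eq_div, one_le_div hp₀]; exact hp)

theorem iSup_rpow_le_tsum {ι : Type*} (u : ι → ℝ≥0∞) {p : ℝ} (hp : 0 < p) :
    (⨆ i, u i) ^ p ≤ ∑' i, u i ^ p := by
  rw [← ENNReal.le_rpow_inv_iff hp]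
  refine iSup_le fun i => ?_
  rw [ENNReal.le_rpow_inv_iff hp]
  exact ENNReal.le_tsum i

theorem biInf_rpow {α : Type*} (B : Set α) (u : α → ℝ≥0∞) {p : ℝ} (hp : 0 < p) :
    (⨅ x ∈ B, u x) ^ p = ⨅ x ∈ B, u x ^ p :=
  (ENNReal.orderIsoRpow p hp).map_iInf₂ fun x (_ : x ∈ B) => u x

end ENNReal

/-! ### Weighted norm estimates. -/

namespace IntrinsicDomain

variable {d : ℕ} {S : IntrinsicDomain d} {ϖ : S.carrier → ℝ} {a : ℝ → ℝ}

theorem wNorm_eq (w f : S.carrier → ℝ) {p : ℝ} (hp : 0 < p) :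
    S.wNorm p w f = (∫⁻ x, ‖f x‖ₑ ^ p ∂S.wm w) ^ (1 / p) := by
  rw [wNorm, eLpNorm_eq_lintegral_rpow_enorm_toReal (by simpa using hp) ENNReal.ofReal_ne_top,
    ENNReal.toReal_ofReal hp.le]

/-- Countability is drawn from `ϖ`, because the weight `w` of the theorem may vanish almost
everywhere. -/
theorem IsLocalizable.countable_of_separated (hS : S.IsLocalizable ϖ a) {ε : ℝ} (hε : 0 < ε)
    {Ξ : Set S.carrier} (hΞ : ∀ x ∈ Ξ, ∀ y ∈ Ξ, x ≠ y → ε ≤ S.dis x y) : Countable Ξ := by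
  obtain ⟨L, -, hL⟩ := hS.doubling
  exact hL.countable_of_separated hS.measure_univ_ne_zero hε hΞ

/-- Two points of a ball of radius `δ / n` are within `2δ / n`, which explains the halved `δ₀` and
the doubled `C`. The oscillation is centred at `y` rather than `z`, so that the error can be
integrated in `y`. -/
theorem IsLocalizable.exists_enorm_le_iInf_add (hS : S.IsLocalizable ϖ a) (ha : IsCutoff a) :
    ∃ δ₀ : ℝ, 0 < δ₀ ∧ ∀ β : ℝ, 0 < β → ∃ C : ℝ, 0 < C ∧ ∀ n : ℕ, 1 ≤ n →
      ∀ f ∈ S.poly n, ∀ δ : ℝ, 0 < δ → δ ≤ δ₀ → ∀ z : S.carrier, ∀ y ∈ S.ball z (δ / n),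
        ‖f y‖ₑ ≤ (⨅ v ∈ S.ball z (δ / n), ‖f v‖ₑ) +
          ENNReal.ofReal (C * δ) * S.peetre β n f y := by
  obtain ⟨δ₀, hδ₀, h⟩ := hS.exists_enorm_sub_le ha
  refine ⟨δ₀ / 2, by positivity, fun β hβ => ?_⟩
  obtain ⟨C, hC, hosc⟩ := h β hβ
  refine ⟨C * 2, by positivity, fun n hn f hf δ hδ hδδ z y hy => ?_⟩
  simp only [ENNReal.iInf_add]
  refine le_iInf₂ fun v hv => ?_
  have hvy : v ∈ S.ball y (2 * δ / n) := by
    refine S.ball_subset_ball ?_ hv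
    have hy' : S.dis z y < δ / n := hy
    rw [S.dis_comm, mul_div_assoc]
    linarith
  have hle := hosc n hn f hf (2 * δ) (by positivity) (by linarith) v y hvy
  rw [mul_assoc C 2 δ]
  refine le_trans ?_ (add_le_add le_rfl hle)
  calc ‖f y‖ₑ = ‖f v - (f v - f y)‖ₑ := by rw [sub_sub_cancel]
    _ ≤ _ := enorm_sub_le

/-- The maximal function of a polynomial is controlled by its infima over balls that cover `Ω`
and are small in comparison with `1 / n`. -/
theorem IsLocalizable.exists_peetre_le_iSup (hS : S.IsLocalizable ϖ a) (ha : IsCutoff a)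
    {β : ℝ} (hβ : 0 < β) : ∃ ε : ℝ, 0 < ε ∧ ∀ n : ℕ, 1 ≤ n → ∀ f ∈ S.poly n,
      ∀ Ξ : Set S.carrier, (∀ x, ∃ z ∈ Ξ, x ∈ S.ball z (ε / n)) → ∀ x,
        S.peetre β n f x ≤ 2 * (2 ^ β *
          ⨆ z : Ξ, (⨅ v ∈ S.ball z (ε / n), ‖f v‖ₑ) * S.growth n x z ^ (-β)) := by
  obtain ⟨δ₀, hδ₀, h⟩ := hS.exists_enorm_le_iInf_add ha
  obtain ⟨C, hC, hosc⟩ := h β hβ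
  -- `δ₀` permits the oscillation bound, `1` keeps `1 + n d(y, z) ≤ 2`, and `1 / (2C)` gives the
  -- factor `1/2` needed for absorption.
  refine ⟨min (min δ₀ 1) (1 / (2 * C)), by positivity, fun n hn f hf Ξ hΞ x => ?_⟩
  set ε := min (min δ₀ 1) (1 / (2 * C)) with hεdef
  have hε : 0 < ε := by positivity
  have hεδ : ε ≤ δ₀ := (min_le_left _ _).trans (min_le_left _ _)
  have hε1 : ε ≤ 1 := (min_le_left _ _).trans (min_le_right _ _)
  have hCε : ENNReal.ofReal (C * ε) ≤ 2⁻¹ := by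
    rw [← ENNReal.ofReal_ofNat 2, ← ENNReal.ofReal_inv_of_pos two_pos]
    refine ENNReal.ofReal_le_ofReal ?_
    calc C * ε ≤ C * (1 / (2 * C)) := by gcongr; exact min_le_right _ _
      _ = 2⁻¹ := by field_simp
  have hn' : (0 : ℝ) < n := by exact_mod_cast hn
  obtain ⟨M, hM, hfM⟩ := hS.exists_enorm_le ha hn hf
  refine le_two_mul_of_le_add_half (ne_top_of_le_ne_top hM (peetre_le hβ.le n hfM x)) ?_
  refine iSup_le fun y => ?_
  obtain ⟨z, hz, hyz⟩ := hΞ y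
  have hg : S.growth n y z ≤ 2 := by
    rw [growth, ← ENNReal.ofReal_ofNat 2]
    refine ENNReal.ofReal_le_ofReal ?_
    have h1 : S.dis z y < ε / n := hyz
    rw [lt_div_iff₀ hn'] at h1
    rw [S.dis_comm]
    linarith
  calc ‖f y‖ₑ * S.growth n x y ^ (-β)
      ≤ ((⨅ v ∈ S.ball z (ε / n), ‖f v‖ₑ) + 2⁻¹ * (S.peetre β n f x * S.growth n x y ^ β)) *
          S.growth n x y ^ (-β) := by
        gcongr
        refine (hosc n hn f hf ε hε hεδ z y hyz).trans ?_
        gcongr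
        exact peetre_le_mul hβ.le n f x y
    _ = (⨅ v ∈ S.ball z (ε / n), ‖f v‖ₑ) * S.growth n x y ^ (-β) +
          2⁻¹ * S.peetre β n f x * (S.growth n x y ^ β * S.growth n x y ^ (-β)) := by ring
    _ = (⨅ v ∈ S.ball z (ε / n), ‖f v‖ₑ) * S.growth n x y ^ (-β) +
          2⁻¹ * S.peetre β n f x := by rw [S.growth_rpow_mul_rpow_neg, mul_one]
    _ ≤ (⨅ v ∈ S.ball z (ε / n), ‖f v‖ₑ) * (2 ^ β * S.growth n x z ^ (-β)) +
          2⁻¹ * S.peetre β n f x := by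
        gcongr
        refine (growth_rpow_neg_le_mul hβ.le n x y z).trans ?_
        gcongr
    _ = 2 ^ β * ((⨅ v ∈ S.ball z (ε / n), ‖f v‖ₑ) * S.growth n x z ^ (-β)) +
          2⁻¹ * S.peetre β n f x := by ring
    _ ≤ _ := by
        gcongr
        exact le_iSup (fun z : Ξ => (⨅ v ∈ S.ball z (ε / n), ‖f v‖ₑ) * S.growth n x z ^ (-β))
          ⟨z, hz⟩

/-- Boundedness of the maximal function of polynomials in weighted `L^p`, uniformly in
`p ≥ p₀`. -/
theorem IsLocalizable.exists_lintegral_peetre_le (hS : S.IsLocalizable ϖ a) (ha : IsCutoff a)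
    (L : ℝ) {p₀ : ℝ} (hp₀ : 0 < p₀) : ∃ β : ℝ, 0 < β ∧ ∃ K : ℝ≥0∞, K ≠ ⊤ ∧
      ∀ w : S.carrier → ℝ, S.IsDoublingWeight L w → ∀ p : ℝ, p₀ ≤ p → ∀ n : ℕ, 1 ≤ n →
        ∀ f ∈ S.poly n, ∫⁻ x, S.peetre β n f x ^ p ∂S.wm w ≤
          K ^ p * ∫⁻ x, ‖f x‖ₑ ^ p ∂S.wm w := by
  obtain ⟨κ, hκ, hLκ⟩ := exists_two_mul_le_two_rpow L
  have hβ : 0 < κ / p₀ := by positivity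
  -- With this choice `βp ≥ κ` for every `p ≥ p₀`.
  refine ⟨κ / p₀, hβ, ?_⟩
  set β := κ / p₀ with hβdef
  obtain ⟨ε, hε, hpeetre⟩ := hS.exists_peetre_le_iSup ha hβ
  -- Here `j` doublings carry a ball of radius `ε / (2n)` past radius `1 / n`.
  obtain ⟨j, hj⟩ := pow_unbounded_of_one_lt (2 / ε) one_lt_two
  set M : ℝ≥0∞ := 2 ^ κ * 2 * ENNReal.ofReal L ^ j with hMdef
  have hM : M ≠ ⊤ := ENNReal.mul_ne_top (ENNReal.mul_ne_top
    (ENNReal.rpow_ne_top_of_nonneg hκ.le ENNReal.ofNat_ne_top) ENNReal.ofNat_ne_top)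
    (ENNReal.pow_ne_top ENNReal.ofReal_ne_top)
  refine ⟨2 * 2 ^ β * max M 1 ^ (1 / p₀), ENNReal.mul_ne_top (ENNReal.mul_ne_top
    ENNReal.ofNat_ne_top (ENNReal.rpow_ne_top_of_nonneg hβ.le ENNReal.ofNat_ne_top))
    (ENNReal.rpow_ne_top_of_nonneg (by positivity) (max_ne_top hM ENNReal.one_ne_top)),
    fun w hw p hp n hn f hf => ?_⟩
  have hp' : 0 < p := hp₀.trans_le hp
  have hn' : (0 : ℝ) < n := by exact_mod_cast hn
  have hεn : 0 < ε / n := by positivity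
  -- An auxiliary net at the fixed scale `ε / n`, unrelated to the set of nodes in the theorem.
  obtain ⟨Ξ, hsep, hcov⟩ := S.exists_separated_cover (ε / n)
  have : Countable Ξ := hS.countable_of_separated hεn hsep
  have hcov' : ∀ x, ∃ z ∈ Ξ, x ∈ S.ball z (ε / n) := fun x => by
    obtain ⟨z, hz, rfl | h⟩ := hcov x
    · exact ⟨x, hz, S.mem_ball_self x hεn⟩
    · exact ⟨z, hz, h⟩
  set I : Ξ → ℝ≥0∞ := fun z => ⨅ v ∈ S.ball z (ε / n), ‖f v‖ₑ
  have hpt : ∀ x, S.peetre β n f x ^ p ≤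
      ∑' z : Ξ, (2 * 2 ^ β) ^ p * I z ^ p * S.growth n z x ^ (-κ) := by
    intro x
    calc S.peetre β n f x ^ p
        ≤ (2 * (2 ^ β * ⨆ z : Ξ, I z * S.growth n x z ^ (-β))) ^ p := by
          gcongr
          exact hpeetre n hn f hf Ξ hcov' x
      _ = (2 * 2 ^ β) ^ p * (⨆ z : Ξ, I z * S.growth n x z ^ (-β)) ^ p := by
          rw [← mul_assoc, ENNReal.mul_rpow_of_nonneg _ _ hp'.le]
      _ ≤ (2 * 2 ^ β) ^ p * ∑' z : Ξ, (I z * S.growth n x z ^ (-β)) ^ p := by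
          gcongr
          exact iSup_rpow_le_tsum _ hp'
      _ = ∑' z : Ξ, (2 * 2 ^ β) ^ p * (I z * S.growth n x z ^ (-β)) ^ p :=
          ENNReal.tsum_mul_left.symm
      _ ≤ _ := by
          refine ENNReal.tsum_le_tsum fun z => ?_
          rw [mul_assoc, ENNReal.mul_rpow_of_nonneg (I z) _ hp'.le,
            ← ENNReal.rpow_mul (S.growth n x z), S.growth_comm n x z]
          have hexp : -β * p ≤ -κ := by
            have : κ = β * p₀ := by rw [hβdef]; field_simp
            rw [this, neg_mul, neg_le_neg_iff]
            gcongr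
          exact mul_le_mul_right (mul_le_mul_right (ENNReal.rpow_le_rpow_of_exponent_le
            (S.one_le_growth n _ _) hexp) _) _
  have hball : ∀ z : Ξ, I z ^ p * S.wm w (S.ball z (1 / n)) ≤
      ENNReal.ofReal L ^ j * ∫⁻ x in S.ball z (ε / n / 2), ‖f x‖ₑ ^ p ∂S.wm w := by
    intro z
    have h₁ : S.wm w (S.ball z (1 / n)) ≤
        ENNReal.ofReal L ^ j * S.wm w (S.ball z (ε / n / 2)) := by
      refine (measure_mono (S.ball_mono z ?_)).trans
        (hw.measure_ball_two_pow_le z (half_pos hεn) j)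
      rw [div_lt_iff₀ hε] at hj
      rw [div_right_comm, mul_div_assoc', div_le_div_iff_of_pos_right hn']
      linarith
    calc I z ^ p * S.wm w (S.ball z (1 / n))
        ≤ I z ^ p * (ENNReal.ofReal L ^ j * S.wm w (S.ball z (ε / n / 2))) := by gcongr
      _ = ENNReal.ofReal L ^ j * ∫⁻ _ in S.ball z (ε / n / 2), I z ^ p ∂S.wm w := by
          rw [setLIntegral_const]; ring
      _ ≤ _ := by
          gcongr ENNReal.ofReal L ^ j * ?_
          refine setLIntegral_mono' (S.measurableSet_ball' _ _) fun v hv => ?_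
          gcongr
          exact iInf₂_le v (S.ball_mono z (half_le_self hεn.le) hv)
  calc ∫⁻ x, S.peetre β n f x ^ p ∂S.wm w
      ≤ ∫⁻ x, ∑' z : Ξ, (2 * 2 ^ β) ^ p * I z ^ p * S.growth n z x ^ (-κ) ∂S.wm w :=
        lintegral_mono hpt
    _ = ∑' z : Ξ, (2 * 2 ^ β) ^ p * I z ^ p * ∫⁻ x, S.growth n z x ^ (-κ) ∂S.wm w := by
        have hm : ∀ z : Ξ, Measurable fun x => S.growth n z x ^ (-κ) := fun z =>
          (S.measurable_growth n z).pow_const _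
        rw [lintegral_tsum fun z => ((hm z).const_mul _).aemeasurable]
        simp only [lintegral_const_mul _ (hm _)]
    _ ≤ ∑' z : Ξ, (2 * 2 ^ β) ^ p * M *
          ∫⁻ x in S.ball z (ε / n / 2), ‖f x‖ₑ ^ p ∂S.wm w := by
        refine ENNReal.tsum_le_tsum fun z => ?_
        calc (2 * 2 ^ β) ^ p * I z ^ p * ∫⁻ x, S.growth n z x ^ (-κ) ∂S.wm w
            ≤ (2 * 2 ^ β) ^ p * I z ^ p * (2 ^ κ * 2 * S.wm w (S.ball z (1 / n))) := by
              gcongr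
              exact hw.lintegral_growth_rpow_neg_le hκ hLκ hn z
          _ = (2 * 2 ^ β) ^ p * (2 ^ κ * 2) * (I z ^ p * S.wm w (S.ball z (1 / n))) := by ring
          _ ≤ (2 * 2 ^ β) ^ p * (2 ^ κ * 2) * (ENNReal.ofReal L ^ j *
                ∫⁻ x in S.ball z (ε / n / 2), ‖f x‖ₑ ^ p ∂S.wm w) := by
              exact mul_le_mul_right (hball z) _
          _ = _ := by rw [hMdef]; ring
    _ ≤ (2 * 2 ^ β) ^ p * M * ∫⁻ x, ‖f x‖ₑ ^ p ∂S.wm w := by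
        rw [ENNReal.tsum_mul_left]
        gcongr
        exact tsum_lintegral_half_balls_le hsep _ _
    _ ≤ _ := by
        rw [ENNReal.mul_rpow_of_nonneg (2 * 2 ^ β) _ hp'.le]
        gcongr
        exact le_max_one_rpow_rpow M hp₀ hp

theorem rpow_one_div_le_of_le {p : ℝ} (hp : 0 < p) {X Y K : ℝ≥0∞} (h : X ≤ K ^ p * Y) :
    X ^ (1 / p) ≤ K * Y ^ (1 / p) := by
  calc X ^ (1 / p) ≤ (K ^ p * Y) ^ (1 / p) := by gcongr
    _ = K * Y ^ (1 / p) := by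
      rw [ENNReal.mul_rpow_of_nonneg _ _ (by positivity), one_div, ENNReal.rpow_rpow_inv hp.ne']

theorem le_ofReal_toReal_add_one {K : ℝ≥0∞} (hK : K ≠ ⊤) : K ≤ ENNReal.ofReal (K.toReal + 1) :=
  (ENNReal.ofReal_toReal hK).symm.le.trans (ENNReal.ofReal_le_ofReal (by linarith))

theorem IsLocalizable.exists_supSum_le (hS : S.IsLocalizable ϖ a) (ha : IsCutoff a)
    (L : ℝ) {p₀ : ℝ} (hp₀ : 0 < p₀) (c : ℝ) : ∃ C : ℝ, 0 < C ∧
      ∀ w : S.carrier → ℝ, S.IsDoublingWeight L w →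
      ∀ p : ℝ, p₀ ≤ p → ∀ n m : ℕ, 1 ≤ n → n ≤ m → (m : ℝ) ≤ c * n →
      ∀ δ : ℝ, 0 < δ → δ ≤ 1 → ∀ Ξ : Set S.carrier, S.IsMaximalSeparated (δ / n) Ξ →
      ∀ f ∈ S.poly m,
        S.supSum p w (δ / n) Ξ f ≤ ENNReal.ofReal C * S.wNorm p w f := by
  obtain ⟨β, hβ, K, hK, hmax⟩ := hS.exists_lintegral_peetre_le ha L hp₀
  set G : ℝ≥0∞ := ENNReal.ofReal (1 + 2 * c)
  set Λ : ℝ≥0∞ := max (ENNReal.ofReal L) 1 ^ (1 / p₀) with hΛ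
  have hG : G ^ β * K * Λ ≠ ⊤ := ENNReal.mul_ne_top (ENNReal.mul_ne_top
    (ENNReal.rpow_ne_top_of_nonneg hβ.le ENNReal.ofReal_ne_top) hK)
    (ENNReal.rpow_ne_top_of_nonneg (by positivity)
      (max_ne_top ENNReal.ofReal_ne_top ENNReal.one_ne_top))
  refine ⟨(G ^ β * K * Λ).toReal + 1, by positivity,
    fun w hw p hp n m hn hnm hmc δ hδ hδ1 Ξ hΞ f hf => ?_⟩
  have hp' : 0 < p := hp₀.trans_le hp
  have hn' : (0 : ℝ) < n := by exact_mod_cast hn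
  have hδn : 0 < δ / n := by positivity
  have : Countable Ξ := hS.countable_of_separated hδn hΞ.separated
  -- Here `d(y, x) ≤ 2 / n` and `m ≤ cn`, so `1 + m d(y, x) ≤ 1 + 2c`; this is the origin of `G`.
  have hpt : ∀ z : Ξ, ∀ y ∈ S.ball z (δ / n / 2),
      (⨆ x ∈ S.ball z (δ / n), ‖f x‖ₑ ^ p) ≤ (G ^ β) ^ p * S.peetre β m f y ^ p := by
    intro z y hy
    refine iSup₂_le fun x hx => ?_
    rw [← ENNReal.mul_rpow_of_nonneg _ _ hp'.le]
    gcongr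
    refine (enorm_le_peetre_mul β m f y x).trans ?_
    rw [mul_comm]
    gcongr
    refine ENNReal.ofReal_le_ofReal ?_
    have hy' : S.dis z y < δ / n / 2 := hy
    have hx' : S.dis z x < δ / n := hx
    have htri := S.dis_triangle y z x
    rw [S.dis_comm y z] at htri
    have hdn : δ / n ≤ 1 / n := by gcongr
    have hd : S.dis y x ≤ 2 / n := by
      have : (2 : ℝ) / n = 1 / n + 1 / n := by ring
      linarith
    have : m * S.dis y x ≤ c * n * (2 / n) :=
      mul_le_mul hmc hd (S.dis_nonneg _ _) ((Nat.cast_nonneg m).trans hmc)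
    have h2 : c * n * (2 / n) = 2 * c := by field_simp
    linarith
  have hsum : ∑' z : Ξ, (⨆ x ∈ S.ball z (δ / n), ‖f x‖ₑ ^ p) * S.wm w (S.ball z (δ / n)) ≤
      (G ^ β * K * Λ) ^ p * ∫⁻ x, ‖f x‖ₑ ^ p ∂S.wm w := by
    calc _ ≤ ∑' z : Ξ, ENNReal.ofReal L * (G ^ β) ^ p *
          ∫⁻ y in S.ball z (δ / n / 2), S.peetre β m f y ^ p ∂S.wm w := by
          refine ENNReal.tsum_le_tsum fun z => ?_
          have hdb := hw.doubling z (δ / n / 2) (half_pos hδn)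
          rw [mul_div_cancel₀ _ two_ne_zero] at hdb
          calc (⨆ x ∈ S.ball z (δ / n), ‖f x‖ₑ ^ p) * S.wm w (S.ball z (δ / n))
              ≤ (⨆ x ∈ S.ball z (δ / n), ‖f x‖ₑ ^ p) *
                (ENNReal.ofReal L * S.wm w (S.ball z (δ / n / 2))) := by gcongr
            _ = ENNReal.ofReal L * ∫⁻ _ in S.ball z (δ / n / 2),
                (⨆ x ∈ S.ball z (δ / n), ‖f x‖ₑ ^ p) ∂S.wm w := by
                rw [setLIntegral_const]; ring
            _ ≤ ENNReal.ofReal L * ∫⁻ y in S.ball z (δ / n / 2),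
                (G ^ β) ^ p * S.peetre β m f y ^ p ∂S.wm w := by
                gcongr ENNReal.ofReal L * ?_
                exact setLIntegral_mono' (S.measurableSet_ball' _ _) (hpt z)
            _ = _ := by
                rw [lintegral_const_mul' _ _ (ENNReal.rpow_ne_top_of_nonneg hp'.le
                  (ENNReal.rpow_ne_top_of_nonneg hβ.le ENNReal.ofReal_ne_top)), mul_assoc]
      _ ≤ ENNReal.ofReal L * (G ^ β) ^ p * ∫⁻ y, S.peetre β m f y ^ p ∂S.wm w := by
          rw [ENNReal.tsum_mul_left]
          gcongr
          exact tsum_lintegral_half_balls_le hΞ.separated _ _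
      _ ≤ Λ ^ p * (G ^ β) ^ p * (K ^ p * ∫⁻ x, ‖f x‖ₑ ^ p ∂S.wm w) := by
          gcongr
          · exact le_max_one_rpow_rpow _ hp₀ hp
          · exact hmax w hw p hp m (hn.trans hnm) f hf
      _ = _ := by
          rw [ENNReal.mul_rpow_of_nonneg _ _ hp'.le, ENNReal.mul_rpow_of_nonneg _ _ hp'.le]
          ring
  rw [wNorm_eq w f hp', supSum]
  refine (rpow_one_div_le_of_le hp' hsum).trans ?_
  gcongr
  exact le_ofReal_toReal_add_one hG

/-- The condition on `η` forces `(2ηK)^p ≤ 1/2` for all `p ≥ r` at once, so the `peetre` term is at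
most half of `∫ |f|^p w` and is absorbed. -/
theorem IsLocalizable.wNorm_le_infSum (hS : S.IsLocalizable ϖ a) (ha : IsCutoff a) {L r : ℝ}
    (hr : 0 < r) {β : ℝ} {K η : ℝ≥0∞} (hηtop : η ≠ ⊤)
    (hη : 2 * η * K * 2 ^ (1 / r) ≤ 1) {w : S.carrier → ℝ} (hw : S.IsDoublingWeight L w)
    {p : ℝ} (hp : r ≤ p) {n : ℕ} (hn : 1 ≤ n) {ε : ℝ} (hε : 0 < ε) {Ξ : Set S.carrier}
    (hΞ : S.IsMaximalSeparated ε Ξ) {f : S.carrier → ℝ} (hf : f ∈ S.poly n)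
    (hmax : ∫⁻ x, S.peetre β n f x ^ p ∂S.wm w ≤ K ^ p * ∫⁻ x, ‖f x‖ₑ ^ p ∂S.wm w)
    (hosc : ∀ z : S.carrier, ∀ y ∈ S.ball z ε,
      ‖f y‖ₑ ≤ (⨅ v ∈ S.ball z ε, ‖f v‖ₑ) + η * S.peetre β n f y) :
    S.wNorm p w f ≤ 2 * 2 ^ (1 / r) * S.infSum p w ε Ξ f := by
  have hp' : 0 < p := hr.trans_le hp
  have := hw.isFiniteMeasure
  have : Countable Ξ := hS.countable_of_separated hε hΞ.separated
  obtain ⟨M, hM, hfM⟩ := hS.exists_enorm_le ha hn hf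
  have htwo : (2 : ℝ≥0∞) ≤ (2 ^ (1 / r)) ^ p := by
    simpa using le_max_one_rpow_rpow 2 hr hp
  have hηp : (2 * η * K) ^ p ≤ 2⁻¹ := by
    rw [ENNReal.le_inv_iff_mul_le]
    calc (2 * η * K) ^ p * 2 ≤ (2 * η * K) ^ p * (2 ^ (1 / r)) ^ p := by gcongr
      _ = (2 * η * K * 2 ^ (1 / r)) ^ p := (ENNReal.mul_rpow_of_nonneg _ _ hp'.le).symm
      _ ≤ 1 := ENNReal.rpow_le_one hη hp'.le
  set X := ∫⁻ x, ‖f x‖ₑ ^ p ∂S.wm w with hX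
  set Y := ∑' z : Ξ, (⨅ x ∈ S.ball z ε, ‖f x‖ₑ ^ p) * S.wm w (S.ball z ε) with hY
  have hXtop : X ≠ ⊤ := by
    refine ne_top_of_le_ne_top ?_ (lintegral_mono fun x =>
      ENNReal.rpow_le_rpow (hfM x) hp'.le)
    rw [lintegral_const]
    exact ENNReal.mul_ne_top (ENNReal.rpow_ne_top_of_nonneg hp'.le hM) (measure_ne_top _ _)
  have hpt : ∀ x, ‖f x‖ₑ ^ p ≤ ∑' z : Ξ, (S.ball z ε).indicator
      (fun _ => 2 ^ p * ⨅ v ∈ S.ball z ε, ‖f v‖ₑ ^ p) x + (2 * η) ^ p * S.peetre β n f x ^ p := by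
    intro x
    obtain ⟨z, hz, hxz⟩ := hΞ.exists_mem_ball x
    calc ‖f x‖ₑ ^ p ≤ ((⨅ v ∈ S.ball z ε, ‖f v‖ₑ) + η * S.peetre β n f x) ^ p := by
          gcongr
          exact hosc z x hxz
      _ ≤ 2 ^ p * ((⨅ v ∈ S.ball z ε, ‖f v‖ₑ) ^ p + (η * S.peetre β n f x) ^ p) :=
          add_rpow_le_two_rpow_mul _ _ hp'.le
      _ = 2 ^ p * (⨅ v ∈ S.ball z ε, ‖f v‖ₑ ^ p) + (2 * η) ^ p * S.peetre β n f x ^ p := by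
          rw [biInf_rpow _ _ hp', ENNReal.mul_rpow_of_nonneg _ _ hp'.le,
            ENNReal.mul_rpow_of_nonneg _ _ hp'.le]
          ring
      _ ≤ _ := by
          gcongr
          refine le_trans ?_ (ENNReal.le_tsum (⟨z, hz⟩ : Ξ))
          rw [Set.indicator_of_mem hxz]
  have hbound : X ≤ 2 ^ p * Y + 2⁻¹ * X := by
    have hm : ∀ z : Ξ, Measurable ((S.ball z ε).indicator
        fun _ : S.carrier => 2 ^ p * ⨅ v ∈ S.ball z ε, ‖f v‖ₑ ^ p) := fun z =>
      measurable_const.indicator (S.measurableSet_ball' _ _)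
    calc X ≤ ∫⁻ x, (∑' z : Ξ, (S.ball z ε).indicator
          (fun _ => 2 ^ p * ⨅ v ∈ S.ball z ε, ‖f v‖ₑ ^ p) x +
            (2 * η) ^ p * S.peetre β n f x ^ p) ∂S.wm w := lintegral_mono hpt
      _ = 2 ^ p * Y + ∫⁻ x, (2 * η) ^ p * S.peetre β n f x ^ p ∂S.wm w := by
          -- Only the first summand has to be measurable, so nothing is required of `peetre`.
          rw [lintegral_add_left (Measurable.tsum hm),
            lintegral_tsum fun z => (hm z).aemeasurable, hY, ← ENNReal.tsum_mul_left]
          simp only [lintegral_indicator_const (S.measurableSet_ball' _ _), mul_assoc]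
      _ ≤ _ := by
          gcongr
          rw [lintegral_const_mul' _ _ (ENNReal.rpow_ne_top_of_nonneg hp'.le
            (ENNReal.mul_ne_top ENNReal.ofNat_ne_top hηtop))]
          calc _ ≤ (2 * η) ^ p * (K ^ p * X) := by gcongr
            _ = (2 * η * K) ^ p * X := by
              rw [ENNReal.mul_rpow_of_nonneg (2 * η) _ hp'.le, mul_assoc]
            _ ≤ _ := by gcongr
  have hfinal : X ≤ (2 * 2 ^ (1 / r)) ^ p * Y := by
    calc X ≤ 2 * (2 ^ p * Y) := le_two_mul_of_le_add_half hXtop hbound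
      _ ≤ (2 ^ (1 / r)) ^ p * (2 ^ p * Y) := by gcongr
      _ = _ := by rw [ENNReal.mul_rpow_of_nonneg _ _ hp'.le]; ring
  rw [wNorm_eq w f hp', infSum]
  exact rpow_one_div_le_of_le hp' hfinal

end IntrinsicDomain
end MZ

/-! ### The uniform norm, and the choice of constants. -/

namespace MZ
namespace IntrinsicDomain

variable {d : ℕ} {S : IntrinsicDomain d} {ϖ : S.carrier → ℝ} {a : ℝ → ℝ}

/-- Since `peetre` never exceeds the sup norm, `η ≤ 1/2` lets half of that norm be absorbed; the
constant `2` is therefore absolute. -/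
theorem IsLocalizable.iSup_enorm_le (hS : S.IsLocalizable ϖ a) (ha : IsCutoff a) {β : ℝ}
    (hβ : 0 < β) {η : ℝ≥0∞} (hη : η ≤ 2⁻¹) {n : ℕ} (hn : 1 ≤ n) {ε : ℝ} (hε : 0 < ε)
    {Ξ : Set S.carrier} (hΞ : S.IsMaximalSeparated ε Ξ) {f : S.carrier → ℝ} (hf : f ∈ S.poly n)
    (hosc : ∀ z : S.carrier, ∀ y ∈ S.ball z ε,
      ‖f y‖ₑ ≤ (⨅ v ∈ S.ball z ε, ‖f v‖ₑ) + η * S.peetre β n f y) :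
    ⨆ x : S.carrier, ‖f x‖ₑ ≤ 2 * ⨆ z ∈ Ξ, ‖f z‖ₑ := by
  obtain ⟨M, hM, hfM⟩ := hS.exists_enorm_le ha hn hf
  refine le_two_mul_of_le_add_half (ne_top_of_le_ne_top hM (iSup_le hfM)) (iSup_le fun x => ?_)
  obtain ⟨z, hz, hxz⟩ := hΞ.exists_mem_ball x
  refine (hosc z x hxz).trans ?_
  gcongr
  · exact (iInf₂_le z (S.mem_ball_self z hε)).trans (le_iSup₂ (f := fun z _ => ‖f z‖ₑ) z hz)
  · exact peetre_le hβ.le n (fun y => le_iSup (fun y => ‖f y‖ₑ) y) x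

end IntrinsicDomain
end MZ

theorem mainTheorem9 {d : ℕ} (S : MZ.IntrinsicDomain d) (ϖ : S.carrier → ℝ) (a : ℝ → ℝ)
    (ha : MZ.IsCutoff a) (hS : S.IsLocalizable ϖ a) :
    -- (i): the constant depends only on the space, the doubling constant, a lower bound for `p`
    -- and the ratio bound `c`
    (∀ L : ℝ, 0 < L → ∀ p₀ : ℝ, 0 < p₀ → ∀ c : ℝ, ∃ C : ℝ, 0 < C ∧
      ∀ w : S.carrier → ℝ, S.IsDoublingWeight L w →
      ∀ p : ℝ, p₀ ≤ p → ∀ n m : ℕ, 1 ≤ n → n ≤ m → (m : ℝ) ≤ c * n →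
      ∀ δ : ℝ, 0 < δ → δ ≤ 1 → ∀ Ξ : Set S.carrier, S.IsMaximalSeparated (δ / n) Ξ →
      ∀ f ∈ S.poly m,
        S.supSum p w (δ / n) Ξ f ≤ ENNReal.ofReal C * S.wNorm p w f) ∧
    -- (ii): `δᵣ` depends only on the space, the doubling constant and `r`
    (∃ c : ℝ, 0 < c ∧ ∀ L : ℝ, 0 < L → ∀ r : ℝ, 0 < r → r < 1 → ∃ δᵣ : ℝ, 0 < δᵣ ∧
      (∃ C : ℝ, 0 < C ∧ ∀ w : S.carrier → ℝ, S.IsDoublingWeight L w →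
        ∀ p : ℝ, r ≤ p → ∀ n : ℕ, 1 ≤ n → ∀ δ : ℝ, 0 < δ → δ ≤ 1 → δ ≤ δᵣ →
        ∀ Ξ : Set S.carrier, S.IsMaximalSeparated (δ / n) Ξ → ∀ f ∈ S.poly n,
          S.wNorm p w f ≤ ENNReal.ofReal C * S.infSum p w (δ / n) Ξ f) ∧
      (∀ n : ℕ, 1 ≤ n → ∀ δ : ℝ, 0 < δ → δ ≤ 1 → δ ≤ δᵣ →
        ∀ Ξ : Set S.carrier, S.IsMaximalSeparated (δ / n) Ξ → ∀ f ∈ S.poly n,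
          ⨆ x : S.carrier, ‖f x‖ₑ ≤ ENNReal.ofReal c * ⨆ z ∈ Ξ, ‖f z‖ₑ)) := by
  refine ⟨fun L _ p₀ hp₀ c => hS.exists_supSum_le ha L hp₀ c, 2, two_pos, fun L _ r hr _ => ?_⟩
  obtain ⟨δ₀, hδ₀, hlocal⟩ := hS.exists_enorm_le_iInf_add ha
  obtain ⟨β, hβ, K, hK, hmax⟩ := hS.exists_lintegral_peetre_le ha L hr
  obtain ⟨C, hC, hosc⟩ := hlocal β hβ
  -- The bound `C δ R ≤ 1` gives the smallness needed in `wNorm_le_infSum`; as `R ≥ 2`, it also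
  -- gives `C δ ≤ 1/2` for the sup norm.
  set R : ℝ := 2 * (K.toReal + 1) * 2 ^ (1 / r) with hR
  have hR2 : 2 ≤ R := by
    have h1 : (1 : ℝ) ≤ 2 ^ (1 / r) := Real.one_le_rpow one_le_two (by positivity)
    have h2 := ENNReal.toReal_nonneg (a := K)
    nlinarith
  have hCR : ∀ δ : ℝ, δ ≤ min δ₀ (1 / (C * R)) → C * δ * R ≤ 1 := by
    intro δ hδ
    calc C * δ * R ≤ C * (1 / (C * R)) * R := by gcongr; exact hδ.trans (min_le_right _ _)
      _ = 1 := by field_simp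
  refine ⟨min δ₀ (1 / (C * R)), by positivity, ⟨2 * 2 ^ (1 / r), by positivity, ?_⟩, ?_⟩
  · intro w hw p hp n hn δ hδ _ hδr Ξ hΞ f hf
    have hn' : (0 : ℝ) < n := by exact_mod_cast hn
    have hη : 2 * ENNReal.ofReal (C * δ) * K * 2 ^ (1 / r) ≤ 1 := by
      calc 2 * ENNReal.ofReal (C * δ) * K * 2 ^ (1 / r)
          ≤ 2 * ENNReal.ofReal (C * δ) * ENNReal.ofReal (K.toReal + 1) * 2 ^ (1 / r) := by
            gcongr
            exact MZ.IntrinsicDomain.le_ofReal_toReal_add_one hK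
        _ = ENNReal.ofReal (C * δ * R) := by
            rw [hR, ENNReal.ofReal_mul (p := C * δ) (by positivity), ENNReal.ofReal_mul (p := 2 * (K.toReal + 1))
              (by positivity), ENNReal.ofReal_mul (p := 2) two_pos.le,
              ← ENNReal.ofReal_rpow_of_pos two_pos, ENNReal.ofReal_ofNat]
            ring
        _ ≤ 1 := by
            rw [ENNReal.ofReal_le_one]
            exact hCR δ hδr
    have h2 : ENNReal.ofReal (2 * 2 ^ (1 / r)) = 2 * 2 ^ (1 / r) := by
      rw [ENNReal.ofReal_mul two_pos.le, ← ENNReal.ofReal_rpow_of_pos two_pos,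
        ENNReal.ofReal_ofNat]
    rw [h2]
    exact hS.wNorm_le_infSum ha hr ENNReal.ofReal_ne_top hη hw hp hn (by positivity) hΞ hf
      (hmax w hw p hp n hn f hf) (hosc n hn f hf δ hδ (hδr.trans (min_le_left _ _)))
  · intro n hn δ hδ _ hδr Ξ hΞ f hf
    have hn' : (0 : ℝ) < n := by exact_mod_cast hn
    have hη : ENNReal.ofReal (C * δ) ≤ 2⁻¹ := by
      rw [← ENNReal.ofReal_ofNat 2, ← ENNReal.ofReal_inv_of_pos two_pos]
      refine ENNReal.ofReal_le_ofReal ?_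
      have h := hCR δ hδr
      have : 0 < C * δ := by positivity
      rw [le_inv_comm₀ this two_pos, ← one_div, le_div_iff₀ this]
      nlinarith
    rw [ENNReal.ofReal_ofNat]
    exact hS.iSup_enorm_le ha hβ hη hn (by positivity) hΞ hf
      (hosc n hn f hf δ hδ (hδr.trans (min_le_left _ _)))
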